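/- **Setting.** Let $\mathcal T_h$ be a conforming mesh of closed triangles of a polygonal domain $\Omega\subset\mathbb R^2$, shape regular in the sense that $h_T\le\sigma\,\rho_T$ for all $T\in\mathcal T_h$, where $h_T$ is the diameter of $T$ and $\rho_T$ the diameter of an inscribed disc. Let $\bar\Omega=\bar\Omega^1\cup\bar\Omega^2$ with disjoint open sets $\Omega^1,\Omega^2$, and let the interface be $\Gamma=\partial\Omega^1\cap\partial\Omega^2$. For every $T$ that meets $\Gamma$, $\Gamma_T=T\cap\Gamma$ is assumed to be a (possibly degenerate) line segment. Let $k_1,k_2>0$ be the values of the coefficient $K$ on $\Omega^1,\Omega^2$, and $k_\Gamma=\frac{k_1k_2}{k_1+k_2}$. Each edge $F$ has length $h_F$ and a fixed unit normal $n_F$, pointing from $T_F^-$ to $T_F^+$ (outward if $F\subset\partial\Omega$); $[\![v]\!]=v^--v^+$ on interior edges and $[\![v]\!]=v$ on boundary edges. For $i=1,2$ let $\mathcal T_h^i$ be the set of triangles meeting $\Omega^i$, $\Omega_h^i$ their union, $\mathcal T_h^\Gamma$ the set of triangles meeting $\Gamma$. Consider one of the following two conventions. (a) $\mathcal F_h^i$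 is the set of edges meeting the open set $\Omega^i$ (so that it contains no edge of $\partial\Omega$), and $\mathcal N^i$ is the set of nodes interior to $\Omega_h^i$. (b) $\mathcal F_h^i$ contains in addition the edges in $\partial\Omega$ that meet $\partial\Omega^i\setminus\Gamma$, and $\mathcal N^i$ is the set of nodes interior to $\Omega_h^i$ relative to $\bar\Omega$; in this case it is assumed that no node lies on more than two edges of $\partial\Omega$. Let $\mathcal F_g^i$ be the set of interior edges in $\mathcal F_h^i$ that belong to a triangle meeting $\Gamma$. Let $\mathcal D_h=\mathcal D_h^1\times\mathcal D_h^2$, where $\mathcal D_h^i$ is the space of functions that are affine on each $T\in\mathcal T_h^i$ (without continuity), and $\mathcal M_h=\mathcal M_h^1\times\mathcal M_h^2$, where $\mathcal M_h^i$ is the space of functions $\mu$ that are affine on each $F\in\mathcal F_h^i$ and satisfy $\sum_{F\in\mathcal F_h^i,\,F\ni N}\mathfrak s_N^F h_F\,\mu_{|F}(N)=0$ for all $N\in\mathcal N^i$, with $\mathfrak s_N^F=1$ if $n_F$ points clockwise around $N$ and $-1$ otherwise. Put $$b_h(\mu,v)=\sum_{i=1}^2\sum_{F\in\mathcal F_h^i}\frac{k_ih_F}{2}\sum_{N\text{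 endpoint of }F}\mu^i_{|F}(N)\,[\![v^i]\!](N),\qquad |||\mu|||_{\mathcal M_h}^2=\sum_{i=1}^2\sum_{F\in\mathcal F_h^i}\int_Fk_ih_F(\mu^i)^2\,ds,$$ $$|||v|||_{\mathcal D_h}^2=\sum_{i=1}^2\Big(\sum_{T\in\mathcal T_h^i}\int_{T\cap\Omega^i}k_i|\nabla v^i|^2dx+\sum_{F\in\mathcal F_g^i}h_F\int_Fk_i[\![\partial_nv^i]\!]^2ds+\sum_{F\in\mathcal F_h^i}\int_Fk_ih_F^{-1}[\![v^i]\!]^2ds\Big)+\sum_{T\in\mathcal T_h^\Gamma}\int_{\Gamma_T}\frac{k_\Gamma}{h_T}(v^1-v^2)^2ds,$$ where on $\Gamma$ the function $v^i$ is the trace taken from $\Omega^i$. **Theorem.** There is a constant $\tilde\beta>0$, depending only on the shape regularity constant $\sigma$ (in particular neither on $h$ nor on $K$), such that under either convention $$\inf_{\mu\in\mathcal M_h}\ \sup_{v\in\mathcal D_h}\ \frac{b_h(\mu,v)}{|||\mu|||_{\mathcal M_h}\,|||v|||_{\mathcal D_h}}\ \ge\ \tilde\beta,$$ where the infimum and the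 supremum are over the elements with $|||\mu|||_{\mathcal M_h}\neq0$ and $|||v|||_{\mathcal D_h}\neq0$. -/

import Mathlib

open scoped Topology RealInnerProductSpace Classical

noncomputable section

namespace CutFEM

/-- The Euclidean plane. -/
abbrev Plane := EuclideanSpace ℝ (Fin 2)

/-- The closed simplex (triangle, edge) spanned by a finite set of vertices. -/
def hull (S : Finset Plane) : Set Plane := convexHull ℝ (S : Set Plane)

/-- The diameter `h_T` of a triangle, the length `h_F` of an edge. -/
def size (S : Finset Plane) : ℝ := Metric.diam (hull S)

/-- A conforming triangular mesh; a triangle is given by the set of its three vertices. -/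
structure TriMesh where
  elems : Finset (Finset Plane)
  card_eq : ∀ T ∈ elems, T.card = 3
  indep : ∀ T ∈ elems, AffineIndependent ℝ ((↑) : T → Plane)
  conforming : ∀ T ∈ elems, ∀ T' ∈ elems, hull T ∩ hull T' = hull (T ∩ T')

namespace TriMesh

variable (𝒯 : TriMesh)

/-- The open polygonal set which is triangulated by the mesh. -/
def domain : Set Plane := interior (⋃ T ∈ 𝒯.elems, hull T)

/-- The edges of the mesh. -/
def edges : Finset (Finset Plane) := 𝒯.elems.biUnion fun T => T.powersetCard 2

/-- The vertices of the mesh. -/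
def nodes : Finset Plane := 𝒯.elems.biUnion id

/-- A boundary edge belongs to one triangle only. -/
def IsBoundaryEdge (F : Finset Plane) : Prop :=
  F ∈ 𝒯.edges ∧ (𝒯.elems.filter fun T => F ⊆ T).card = 1

/-- The ratio of the diameter of each triangle to the diameter of an inscribed disc is at
most `σ`. -/
def ShapeRegular (σ : ℝ) : Prop :=
  ∀ T ∈ 𝒯.elems, ∃ c : Plane, ∃ r : ℝ, 0 < r ∧ Metric.closedBall c r ⊆ hull T ∧
    size T ≤ σ * (2 * r)

/-- The boundary of the domain has no pinch points: no vertex lies on more than two boundary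
edges. -/
def SimpleBoundary : Prop :=
  ∀ N ∈ 𝒯.nodes, (𝒯.edges.filter fun F => 𝒯.IsBoundaryEdge F ∧ N ∈ F).card ≤ 2

end TriMesh

/-- Two disjoint open sets decompose the meshed domain; their common boundary, the interface
`Γ`, meets each triangle that it meets in a (possibly degenerate) segment. Every edge carries
a fixed unit normal, which points outward on the boundary edges. -/
structure CutMesh extends TriMesh where
  sub : Fin 2 → Set Plane
  isOpen_sub : ∀ i, IsOpen (sub i)
  disjoint_sub : Disjoint (sub 0) (sub 1)
  closure_sub : closure toTriMesh.domain = closure (sub 0) ∪ closure (sub 1)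
  segment_cut : ∀ T ∈ elems, (hull T ∩ (frontier (sub 0) ∩ frontier (sub 1))).Nonempty →
    ∃ a b : Plane, hull T ∩ (frontier (sub 0) ∩ frontier (sub 1)) = segment ℝ a b
  normal : Finset Plane → Plane
  normal_unit : ∀ F ∈ toTriMesh.edges, ‖normal F‖ = 1
  normal_perp : ∀ F ∈ toTriMesh.edges, ∀ x ∈ F, ∀ y ∈ F, ⟪normal F, y - x⟫ = 0
  normal_outward : ∀ F, toTriMesh.IsBoundaryEdge F → ∀ T ∈ elems, F ⊆ T →
    ∀ x ∈ F, ∀ y ∈ T, ⟪normal F, y - x⟫ ≤ 0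

/-- The two ways of treating the edges on the outer boundary: they are left out of the edge
sets of the subdomains, or they are included (with jump equal to the trace). -/
inductive BoundaryEdges
  | omitted
  | included

/-- A family of affine functions: one for each subdomain and each triangle (respectively edge).
Only its restriction to that triangle (edge) matters. -/
abbrev Broken := Fin 2 → Finset Plane → (Plane →ᵃ[ℝ] ℝ)

namespace CutMesh

variable (𝒯 : CutMesh)

/-- The interface `Γ`. -/
def Γ : Set Plane := frontier (𝒯.sub 0) ∩ frontier (𝒯.sub 1)

/-- The triangles `𝒯_h^i` which meet the `i`-th subdomain. -/
def subElems (i : Fin 2) : Finset (Finset Plane) :=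
  𝒯.elems.filter fun T => (hull T ∩ 𝒯.sub i).Nonempty

/-- The extended subdomain `Ω_h^i`. -/
def extDomain (i : Fin 2) : Set Plane := ⋃ T ∈ 𝒯.subElems i, hull T

/-- The edges `ℱ_h^i` which meet the `i`-th (open) subdomain; if the boundary edges are
included, also those boundary edges which meet `∂Ω^i ∖ Γ`. -/
def subEdges (c : BoundaryEdges) (i : Fin 2) : Finset (Finset Plane) :=
  𝒯.edges.filter fun F => (hull F ∩ 𝒯.sub i).Nonempty ∨
    (c = .included ∧ 𝒯.IsBoundaryEdge F ∧ (hull F ∩ (frontier (𝒯.sub i) \ 𝒯.Γ)).Nonempty)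

/-- The cut triangles `𝒯_h^Γ`. -/
def cutElems : Finset (Finset Plane) := 𝒯.elems.filter fun T => (hull T ∩ 𝒯.Γ).Nonempty

/-- The ghost penalty edges `ℱ_g^i`: the edges of `ℱ_h^i` shared by two triangles of which at
least one meets `Γ`. -/
def ghostEdges (c : BoundaryEdges) (i : Fin 2) : Finset (Finset Plane) :=
  (𝒯.subEdges c i).filter fun F => ¬ 𝒯.IsBoundaryEdge F ∧ ∃ T ∈ 𝒯.cutElems, F ⊆ T

/-- The triangle `T_F^-`, out of which the normal of `F` points (as a set with at most one
element). -/
def minusElems (F : Finset Plane) : Finset (Finset Plane) :=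
  𝒯.elems.filter fun T => F ⊆ T ∧ ∀ x ∈ F, ∀ y ∈ T, ⟪𝒯.normal F, y - x⟫ ≤ 0

/-- The triangle `T_F^+`, into which the normal of `F` points; none for a boundary edge. -/
def plusElems (F : Finset Plane) : Finset (Finset Plane) :=
  𝒯.elems.filter fun T => F ⊆ T ∧ ∀ x ∈ F, ∀ y ∈ T, 0 ≤ ⟪𝒯.normal F, y - x⟫

/-- The jump `q^- - q^+` across the edge `F` of a quantity given triangle by triangle; on a
boundary edge it is the trace. -/
def jump (q : Finset Plane → Plane → ℝ) (F : Finset Plane) (x : Plane) : ℝ :=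
  (∑ T ∈ 𝒯.minusElems F, q T x) - ∑ T ∈ 𝒯.plusElems F, q T x

/-- `[[v^i]]` -/
def jumpVal (v : Broken) (i : Fin 2) (F : Finset Plane) (x : Plane) : ℝ :=
  𝒯.jump (fun T => v i T) F x

/-- `[[∂_n v^i]]` -/
def jumpDeriv (v : Broken) (i : Fin 2) (F : Finset Plane) (x : Plane) : ℝ :=
  𝒯.jump (fun T y => ⟪gradient (v i T) y, 𝒯.normal F⟫) F x

/-- The trace on `T ∩ Γ` of `v^i` from the `i`-th subdomain: it is taken from `T` if `T` meets
that subdomain; otherwise `T ∩ Γ` is an edge of `T` (or a point), and it is taken from the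
triangle on the other side of that edge. -/
def trace (v : Broken) (i : Fin 2) (T : Finset Plane) (x : Plane) : ℝ :=
  if T ∈ 𝒯.subElems i then v i T x
  else ∑ T' ∈ (𝒯.subElems i).filter (fun T' => hull T ∩ 𝒯.Γ ⊆ hull T'), v i T' x

/-- The harmonic mean `k_Γ` of the coefficients. -/
def kΓ (k : Fin 2 → ℝ) : ℝ := k 0 * k 1 / (k 0 + k 1)

/-- The ghost penalty term `j_i(v,v)`. -/
def ghost (c : BoundaryEdges) (k : Fin 2 → ℝ) (v : Broken) (i : Fin 2) : ℝ :=
  ∑ F ∈ 𝒯.ghostEdges c i,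
    size F * ∫ x in hull F, k i * 𝒯.jumpDeriv v i F x ^ 2 ∂MeasureTheory.Measure.hausdorffMeasure 1

/-- The square of the norm `‖v‖_h`. -/
def normHSq (c : BoundaryEdges) (k : Fin 2 → ℝ) (v : Broken) : ℝ :=
  (∑ i, (k i * (∑ T ∈ 𝒯.subElems i, ∫ x in hull T ∩ 𝒯.sub i, ‖gradient (v i T) x‖ ^ 2)
      + 𝒯.ghost c k v i))
    + ∑ T ∈ 𝒯.cutElems, ∫ x in hull T ∩ 𝒯.Γ,
        kΓ k / size T * (𝒯.trace v 0 T x - 𝒯.trace v 1 T x) ^ 2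
          ∂MeasureTheory.Measure.hausdorffMeasure 1

/-- The norm `|||v|||` on the broken space. -/
def normD (c : BoundaryEdges) (k : Fin 2 → ℝ) (v : Broken) : ℝ :=
  √(𝒯.normHSq c k v + ∑ i, ∑ F ∈ 𝒯.subEdges c i,
    ∫ x in hull F, k i * (size F)⁻¹ * 𝒯.jumpVal v i F x ^ 2
      ∂MeasureTheory.Measure.hausdorffMeasure 1)

/-- The norm `|||μ|||` on the multipliers. -/
def normM (c : BoundaryEdges) (k : Fin 2 → ℝ) (μ : Broken) : ℝ :=
  √(∑ i, ∑ F ∈ 𝒯.subEdges c i,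
    ∫ x in hull F, k i * size F * (μ i F x) ^ 2 ∂MeasureTheory.Measure.hausdorffMeasure 1)

/-- The bilinear form `b_h`. -/
def b (c : BoundaryEdges) (k : Fin 2 → ℝ) (μ v : Broken) : ℝ :=
  ∑ i, ∑ F ∈ 𝒯.subEdges c i, k i * size F / 2 * ∑ N ∈ F, μ i F N * 𝒯.jumpVal v i F N

/-- The sign `𝔰_N^F`: it is `1` if the normal of the edge `F` points in the clockwise direction
around its endpoint `N`, and `-1` otherwise. -/
def edgeSign (N : Plane) (F : Finset Plane) : ℝ :=
  if ∃ M ∈ F, 0 < 𝒯.normal F 0 * (M 1 - N 1) - 𝒯.normal F 1 * (M 0 - N 0) then 1 else -1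

/-- The nodes which carry a constraint: those interior to `Ω_h^i`; if the boundary edges are
included, interior is understood relative to the closed domain. -/
def constrainedNodes (c : BoundaryEdges) (i : Fin 2) : Finset Plane :=
  𝒯.nodes.filter fun N =>
    match c with
    | .omitted => N ∈ interior (𝒯.extDomain i)
    | .included => 𝒯.extDomain i ∈ 𝓝[closure 𝒯.domain] N

/-- The broken space `𝒟_h` of piecewise affine functions on `𝒯_h^1` and `𝒯_h^2`. -/
def Dh : Set Broken := {v | ∀ i, ∀ T ∉ 𝒯.subElems i, v i T = 0}

/-- The multiplier space `ℳ_h`. -/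
def Mh (c : BoundaryEdges) : Set Broken :=
  {μ | (∀ i, ∀ F ∉ 𝒯.subEdges c i, μ i F = 0) ∧
    ∀ i, ∀ N ∈ 𝒯.constrainedNodes c i,
      ∑ F ∈ (𝒯.subEdges c i).filter (fun F => N ∈ F),
        𝒯.edgeSign N F * size F * μ i F N = 0}

end CutMesh

end CutFEM

end

noncomputable section

namespace CutFEM

/-! Given a multiplier `μ`, a broken function `v` is built whose jump on every edge of `ℱ_h^i` is
exactly `h_F μ^i`, with values controlled by those jumps. Then `b_h(μ, v)` is half the weighted
nodal sum `S` of the squares `(h_F μ_F(N))²`, while both norms are at most a constant times `√S`,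
and the quotient is bounded below.

An affine function on a triangle has free vertex values, so the construction splits into one linear
system per node `N`: the unknowns are the values at `N` from the triangles around `N`, the equations
are the jumps on the edges at `N`, and the matrix consists of incidence numbers in `{-1, 0, 1}`. By
duality the system is solvable iff its right-hand side is orthogonal to the left kernel. In a
triangle at `N` its two edges at `N` enter with opposite orientation, so a kernel vector divided by
the signs `𝔰_N^F` takes equal values on both, and vanishes on one if the other is missing from
`ℱ_h^i`. A nonzero value therefore propagates from triangle to triangle and never reaches a missing
edge. A topological argument (`mem_of_no_boundary`, `mem_of_simpleBoundary`) shows that it reaches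
all edges at `N`. Then `N` carries a constraint (`mem_constrainedNodes`), the kernel vector is a
multiple of the signs, and orthogonality is precisely that constraint (`sum_mul_eq_zero_of_kernel`).

Shape regularity bounds the size of the systems (`card_elems_le`, `card_edges_le`). Only finitely
many matrices then occur, which makes the solution bound uniform (`exists_uniform_solution_bound`).
Inverse inequalities for affine functions estimate the remaining terms of the norm of `v` by its
values (`normHSq_le`); the interface term is independent of the contrast because `k_Γ ≤ k_i`. -/

/-! ### Triangles in coordinates given by cross products. -/

/-- The cross product of two plane vectors. -/
def cross (u w : Plane) : ℝ := u 0 * w 1 - u 1 * w 0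

lemma cross_swap (u w : Plane) : cross w u = -cross u w := by unfold cross; ring

@[fun_prop]
lemma continuous_cross_left (a w : Plane) : Continuous fun y : Plane => cross (y - a) w := by
  unfold cross
  simp only [PiLp.sub_apply]
  fun_prop

@[fun_prop]
lemma continuous_cross_right (a w : Plane) : Continuous fun y : Plane => cross w (y - a) := by
  unfold cross
  simp only [PiLp.sub_apply]
  fun_prop

/-- Cramer's rule in the basis `M - N`, `P - N`. -/
lemma eq_add_cross {N M P : Plane} (h : cross (M - N) (P - N) ≠ 0) (y : Plane) :
    y = N + (cross (y - N) (P - N) / cross (M - N) (P - N)) • (M - N)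
      + (cross (M - N) (y - N) / cross (M - N) (P - N)) • (P - N) := by
  ext j
  simp only [PiLp.add_apply, PiLp.smul_apply, smul_eq_mul]
  field_simp
  fin_cases j <;> simp [cross] <;> ring

lemma cross_ne_zero_of_affineIndependent {T : Finset Plane}
    (hT : AffineIndependent ℝ ((↑) : T → Plane)) {N M P : Plane} (hN : N ∈ T) (hM : M ∈ T)
    (hP : P ∈ T) (hNM : N ≠ M) (hNP : N ≠ P) (hMP : M ≠ P) :
    cross (M - N) (P - N) ≠ 0 := by
  intro h
  have hinj : Function.Injective (![⟨N, hN⟩, ⟨M, hM⟩, ⟨P, hP⟩] : Fin 3 → T) := by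
    intro a b hab
    fin_cases a <;> fin_cases b <;> simp_all
  -- If `u = M - N` and `w = P - N` are parallel, then `|u|² w - (u·w) u = 0` is an affine relation
  -- between the vertices; its coefficient `|u|²` at `P` must vanish.
  have hA := (affineIndependent_iff (k := ℝ)).1 (hT.comp_embedding ⟨_, hinj⟩) Finset.univ
    ![((M 0 - N 0) * (P 0 - N 0) + (M 1 - N 1) * (P 1 - N 1))
        - ((M 0 - N 0) ^ 2 + (M 1 - N 1) ^ 2),
      -((M 0 - N 0) * (P 0 - N 0) + (M 1 - N 1) * (P 1 - N 1)),
      (M 0 - N 0) ^ 2 + (M 1 - N 1) ^ 2]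
    (by simp only [Fin.sum_univ_three]; simp; ring) (by
      simp only [Fin.sum_univ_three]
      simp only [cross, PiLp.sub_apply] at h
      ext j
      fin_cases j
      · simp
        linear_combination (-(M 1 - N 1)) * h
      · simp
        linear_combination ((M 0 - N 0)) * h) 2 (Finset.mem_univ _)
  refine hNM ?_
  simp at hA
  ext j
  fin_cases j
  · simp; nlinarith [sq_nonneg (M 0 - N 0), sq_nonneg (M 1 - N 1)]
  · simp; nlinarith [sq_nonneg (M 0 - N 0), sq_nonneg (M 1 - N 1)]

lemma mem_hull_of_mem {S : Finset Plane} {x : Plane} (h : x ∈ S) : x ∈ hull S :=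
  subset_convexHull ℝ _ h

lemma convex_hull (S : Finset Plane) : Convex ℝ (hull S) := convex_convexHull ℝ _

lemma isCompact_hull (S : Finset Plane) : IsCompact (hull S) :=
  Set.Finite.isCompact_convexHull (𝕜 := ℝ) S.finite_toSet

lemma hull_mono {S T : Finset Plane} (h : S ⊆ T) : hull S ⊆ hull T :=
  convexHull_mono (by exact_mod_cast h)

lemma hull_pair (a b : Plane) : hull {a, b} = segment ℝ a b := by
  simp [hull, convexHull_pair]

lemma dist_le_size {S : Finset Plane} {x y : Plane} (hx : x ∈ hull S) (hy : y ∈ hull S) :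
    dist x y ≤ size S := Metric.dist_le_diam_of_mem (isCompact_hull S).isBounded hx hy

lemma size_mono {S T : Finset Plane} (h : S ⊆ T) : size S ≤ size T :=
  Metric.diam_mono (hull_mono h) (isCompact_hull T).isBounded

lemma size_nonneg (S : Finset Plane) : 0 ≤ size S := Metric.diam_nonneg

lemma size_pair (a b : Plane) : size {a, b} = dist a b := by
  rw [size, hull, convexHull_diam]; simp [Metric.diam_pair]

/-- A triangle with vertex `N` and signed area `D / 2` in terms of linear inequalities. -/
lemma mem_hull_iff {N M P : Plane} (h : cross (M - N) (P - N) ≠ 0) (y : Plane) :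
    y ∈ hull {N, M, P} ↔
      0 ≤ cross (M - N) (P - N) * cross (y - N) (P - N) ∧
      0 ≤ cross (M - N) (P - N) * cross (M - N) (y - N) ∧
      cross (M - N) (P - N) * (cross (y - N) (P - N) + cross (M - N) (y - N))
        ≤ cross (M - N) (P - N) ^ 2 := by
  set D := cross (M - N) (P - N) with hD
  constructor
  · intro hy
    -- The factor `D` makes the inequalities independent of the orientation of the triangle.
    have hc : Convex ℝ {y : Plane | 0 ≤ D * cross (y - N) (P - N) ∧
        0 ≤ D * cross (M - N) (y - N) ∧
        D * (cross (y - N) (P - N) + cross (M - N) (y - N)) ≤ D ^ 2} := by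
      intro x hx y hy a b ha hb hab
      obtain ⟨hx1, hx2, hx3⟩ := hx
      obtain ⟨hy1, hy2, hy3⟩ := hy
      have e1 : cross (a • x + b • y - N) (P - N)
          = a * cross (x - N) (P - N) + b * cross (y - N) (P - N) := by
        simp only [cross, PiLp.sub_apply, PiLp.add_apply, PiLp.smul_apply, smul_eq_mul]
        obtain rfl : b = 1 - a := by linarith
        ring
      have e2 : cross (M - N) (a • x + b • y - N)
          = a * cross (M - N) (x - N) + b * cross (M - N) (y - N) := by
        simp only [cross, PiLp.sub_apply, PiLp.add_apply, PiLp.smul_apply, smul_eq_mul]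
        obtain rfl : b = 1 - a := by linarith
        ring
      simp only [Set.mem_ofPred_eq, e1, e2]
      refine ⟨?_, ?_, ?_⟩
      · have := add_nonneg (mul_nonneg ha hx1) (mul_nonneg hb hy1)
        linarith
      · have := add_nonneg (mul_nonneg ha hx2) (mul_nonneg hb hy2)
        linarith
      · have := add_le_add (mul_le_mul_of_nonneg_left hx3 ha) (mul_le_mul_of_nonneg_left hy3 hb)
        have e : a * D ^ 2 + b * D ^ 2 = D ^ 2 := by rw [← add_mul, hab, one_mul]
        linarith
    refine convexHull_min ?_ hc hy
    intro z hz
    have h0 : ∀ u : Plane, cross u u = 0 := fun u => by unfold cross; ring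
    have h1 : ∀ u : Plane, cross u (N - N) = 0 := fun u => by simp [cross]
    have h2 : ∀ u : Plane, cross (N - N) u = 0 := fun u => by simp [cross]
    simp only [Finset.coe_insert, Finset.coe_singleton, Set.mem_insert_iff,
      Set.mem_singleton_iff] at hz
    rcases hz with rfl | rfl | rfl
    · simp only [Set.mem_ofPred_eq, h1, h2]
      simp [sq_nonneg]
    · simp only [Set.mem_ofPred_eq, h0, ← hD]
      refine ⟨mul_self_nonneg _, by simp, by nlinarith⟩
    · simp only [Set.mem_ofPred_eq, h0, ← hD]
      refine ⟨by simp, mul_self_nonneg _, by nlinarith⟩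
  · rintro ⟨h1, h2, h3⟩
    have hD2 : 0 < D ^ 2 := by positivity
    set a := cross (y - N) (P - N) / D with ha
    set b := cross (M - N) (y - N) / D with hb
    have ha0 : 0 ≤ a := by
      have : a = D * cross (y - N) (P - N) / D ^ 2 := by rw [ha]; field_simp
      rw [this]; positivity
    have hb0 : 0 ≤ b := by
      have : b = D * cross (M - N) (y - N) / D ^ 2 := by rw [hb]; field_simp
      rw [this]; positivity
    have hab : a + b ≤ 1 := by
      have : a + b = D * (cross (y - N) (P - N) + cross (M - N) (y - N)) / D ^ 2 := by
        rw [ha, hb]; field_simp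
      rw [this, div_le_one hD2]; exact h3
    have hy : y = (1 - a - b) • N + a • M + b • P := by
      conv_lhs => rw [eq_add_cross h y]
      rw [← hD, ← ha, ← hb]
      module
    rw [hy]
    have := (convex_hull {N, M, P}).sum_mem (t := Finset.univ) (w := ![1 - a - b, a, b])
      (z := ![N, M, P]) (by
        intro j _
        fin_cases j
        · simp; linarith
        · simpa using ha0
        · simpa using hb0) (by simp [Fin.sum_univ_three]; ring) (by
        intro j _
        fin_cases j <;> exact mem_hull_of_mem (by simp))
    simpa [Fin.sum_univ_three] using this

/-! ### Faces, vertices and null sets in a conforming mesh. -/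

namespace TriMesh

variable {𝒯 : TriMesh}

lemma exists_vertices {T F : Finset Plane} (hT : T ∈ 𝒯.elems) (hF : F ⊆ T) (hc : F.card = 2)
    {N : Plane} (hN : N ∈ F) :
    ∃ M P, M ≠ N ∧ F = {N, M} ∧ T = {N, M, P} ∧ P ∉ F ∧ cross (M - N) (P - N) ≠ 0 := by
  obtain ⟨M, hM⟩ : ∃ M, F.erase N = {M} := Finset.card_eq_one.1 (by
    rw [Finset.card_erase_of_mem hN, hc])
  have hMF : M ∈ F.erase N := by rw [hM]; simp
  have hFe : F = {N, M} := by rw [← Finset.insert_erase hN, hM]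
  obtain ⟨P, hP⟩ : ∃ P, T \ F = {P} := Finset.card_eq_one.1 (by
    rw [Finset.card_sdiff_of_subset hF, hc, 𝒯.card_eq T hT])
  have hPT : P ∈ T \ F := by rw [hP]; simp
  have hTe : T = {N, M, P} := by
    rw [← Finset.union_sdiff_of_subset hF, hP, hFe]
    ext; simp
  rw [Finset.mem_sdiff] at hPT
  rw [Finset.mem_erase] at hMF
  refine ⟨M, P, hMF.1, hFe, hTe, hPT.2, ?_⟩
  refine cross_ne_zero_of_affineIndependent (𝒯.indep T hT) (hF hN) (hF hMF.2) hPT.1 hMF.1.symm ?_ ?_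
  · rintro rfl; exact hPT.2 hN
  · rintro rfl; exact hPT.2 hMF.2

lemma mem_edges {F : Finset Plane} :
    F ∈ 𝒯.edges ↔ ∃ T ∈ 𝒯.elems, F ⊆ T ∧ F.card = 2 := by
  simp [edges, Finset.mem_powersetCard]

lemma card_edge {F : Finset Plane} (hF : F ∈ 𝒯.edges) : F.card = 2 := by
  obtain ⟨T, -, -, h⟩ := mem_edges.1 hF
  exact h

lemma exists_edge {T : Finset Plane} (hT : T ∈ 𝒯.elems) {N : Plane} (hN : N ∈ T) :
    ∃ F, F ⊆ T ∧ F.card = 2 ∧ N ∈ F := by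
  obtain ⟨F, h1, h2, h3⟩ := Finset.exists_subsuperset_card_eq (s := {N}) (t := T) (n := 2)
    (by simpa using hN) (by simp) (by rw [𝒯.card_eq T hT]; norm_num)
  exact ⟨F, h2, h3, h1 (by simp)⟩

lemma interior_hull_nonempty {T : Finset Plane} (hT : T ∈ 𝒯.elems) :
    (interior (hull T)).Nonempty := by
  rw [hull, interior_convexHull_nonempty_iff_affineSpan_eq_top]
  have := (𝒯.indep T hT).affineSpan_eq_top_iff_card_eq_finrank_add_one.2
    (by simp [𝒯.card_eq T hT])
  simpa using this

lemma closure_interior_hull {T : Finset Plane} (hT : T ∈ 𝒯.elems) :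
    closure (interior (hull T)) = hull T := by
  rw [(convex_hull T).closure_interior_eq_closure_of_nonempty_interior
    (interior_hull_nonempty hT), (isCompact_hull T).isClosed.closure_eq]

lemma volume_hull_eq_zero {S : Finset Plane} (hS : S.card ≤ 2) :
    MeasureTheory.volume (hull S) = 0 := by
  rcases S.eq_empty_or_nonempty with rfl | hne
  · simp [hull]
  refine MeasureTheory.measure_mono_null (convexHull_subset_affineSpan _)
    (MeasureTheory.Measure.addHaar_affineSubspace _ _ ?_)
  intro h
  have : Nonempty S := hne.to_subtype
  have h1 := finrank_vectorSpan_range_add_one_le ℝ ((↑) : S → Plane)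
  have h2 : Set.range ((↑) : S → Plane) = (S : Set Plane) := by ext; simp
  rw [h2, ← direction_affineSpan, h, AffineSubspace.direction_top, finrank_top] at h1
  simp at h1
  omega

/-- By conformity distinct triangles intersect in the hull of at most two points, which lies in a
line. -/
lemma volume_hull_inter {T T' : Finset Plane} (hT : T ∈ 𝒯.elems) (hT' : T' ∈ 𝒯.elems)
    (h : T ≠ T') : MeasureTheory.volume (hull T ∩ hull T') = 0 := by
  rw [𝒯.conforming T hT T' hT']
  apply volume_hull_eq_zero
  by_contra! hc
  have h1 : T ∩ T' = T := Finset.eq_of_subset_of_card_le Finset.inter_subset_left (by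
    rw [𝒯.card_eq T hT]; omega)
  have h2 : T ∩ T' = T' := Finset.eq_of_subset_of_card_le Finset.inter_subset_right (by
    rw [𝒯.card_eq T' hT']; omega)
  exact h (h1.symm.trans h2)

/-- An open set inside a triangle is not covered by finitely many other triangles. -/
lemma mem_of_isOpen_subset {T : Finset Plane} (hT : T ∈ 𝒯.elems) {O : Set Plane} (hO : IsOpen O)
    (hne : O.Nonempty) (hOT : O ⊆ hull T) {𝒜 : Finset (Finset Plane)} (h𝒜 : 𝒜 ⊆ 𝒯.elems)
    (hO𝒜 : O ⊆ ⋃ T' ∈ 𝒜, hull T') : T ∈ 𝒜 := by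
  by_contra hTA
  have h0 : MeasureTheory.volume (⋃ T' ∈ 𝒜, hull T ∩ hull T') = 0 := by
    refine (MeasureTheory.measure_biUnion_null_iff 𝒜.countable_toSet).2 fun T' hT' => ?_
    exact volume_hull_inter hT (h𝒜 hT') (by rintro rfl; exact hTA hT')
  have h1 : (MeasureTheory.volume : MeasureTheory.Measure Plane) O = 0 := by
    refine MeasureTheory.measure_mono_null ?_ h0
    rw [← Set.inter_iUnion₂]
    exact Set.subset_inter hOT hO𝒜
  exact hne.ne_empty ((hO.measure_eq_zero_iff MeasureTheory.volume).1 h1)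

/-- A vertex of the mesh lies in no triangle of which it is not a vertex. -/
lemma mem_of_mem_hull {T T' : Finset Plane} (hT : T ∈ 𝒯.elems) (hT' : T' ∈ 𝒯.elems) {N : Plane}
    (hN : N ∈ T) (h : N ∈ hull T') : N ∈ T' := by
  have h1 : N ∈ hull (T ∩ T') := by
    rw [← 𝒯.conforming T hT T' hT']; exact ⟨mem_hull_of_mem hN, h⟩
  have h2 : N ∈ convexHull ℝ (({N} : Finset Plane) : Set Plane) ∩ hull (T ∩ T') :=
    ⟨by simp, h1⟩
  -- Hulls of subsets of an affinely independent set intersect in the hull of the common vertices,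
  -- so `N ∉ T'` would make the intersection with `{N}` empty.
  have h3 := (𝒯.indep T hT).convexHull_inter (t₁ := {N}) (t₂ := T ∩ T') (by simpa using hN)
    Finset.inter_subset_left
  rw [hull, ← h3] at h2
  by_contra hc
  have : ({N} : Finset Plane) ∩ (T ∩ T') = ∅ := by
    ext x; simp only [Finset.mem_inter, Finset.mem_singleton]
    constructor
    · rintro ⟨rfl, -, h⟩; exact absurd h hc
    · simp
  rw [← Finset.coe_inter, this] at h2
  simp at h2

end TriMesh
-- Local shape of a triangle: half planes at edges, cones at vertices.
lemma exists_pos_add_smul_mem {x : Plane} {U : Set Plane} (hU : U ∈ 𝓝 x) (w : Plane) :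
    ∃ t : ℝ, 0 < t ∧ x + t • w ∈ U := by
  have h : Filter.Tendsto (fun t : ℝ => x + t • w) (𝓝[>] 0) (𝓝 x) := by
    have : Filter.Tendsto (fun t : ℝ => x + t • w) (𝓝 0) (𝓝 (x + (0 : ℝ) • w)) :=
      Continuous.tendsto (by fun_prop) 0
    rw [zero_smul, add_zero] at this
    exact this.mono_left nhdsWithin_le_nhds
  obtain ⟨t, h1, h2⟩ := ((h.eventually hU).and self_mem_nhdsWithin).exists
  exact ⟨t, h2, h1⟩

lemma cross_add_smul_left (x N u w : Plane) (t : ℝ) :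
    cross (x + t • u - N) w = cross (x - N) w + t * cross u w := by
  simp only [cross, PiLp.sub_apply, PiLp.add_apply, PiLp.smul_apply, smul_eq_mul]; ring

lemma cross_add_smul_right (x N u w : Plane) (t : ℝ) :
    cross w (x + t • u - N) = cross w (x - N) + t * cross w u := by
  simp only [cross, PiLp.sub_apply, PiLp.add_apply, PiLp.smul_apply, smul_eq_mul]; ring

@[simp] lemma cross_self (u : Plane) : cross u u = 0 := by unfold cross; ring
@[simp] lemma cross_zero_left (u : Plane) : cross 0 u = 0 := by simp [cross]
@[simp] lemma cross_zero_right (u : Plane) : cross u 0 = 0 := by simp [cross]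

/-- Near an inner point of an edge, a triangle is a half plane. -/
lemma eventually_mem_hull_of_edge {N M P : Plane} (h : cross (M - N) (P - N) ≠ 0) {s : ℝ}
    (hs0 : 0 < s) (hs1 : s < 1) :
    ∀ᶠ y in 𝓝 (N + s • (M - N)),
      0 ≤ cross (M - N) (P - N) * cross (M - N) (y - N) → y ∈ hull {N, M, P} := by
  set D := cross (M - N) (P - N) with hD
  have hD2 : 0 < D ^ 2 := by positivity
  have e1 : cross (N + s • (M - N) - N) (P - N) = s * D := by
    rw [cross_add_smul_left]; simp [hD]
  have e2 : cross (M - N) (N + s • (M - N) - N) = 0 := by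
    rw [cross_add_smul_right]; simp
  have h1 : ∀ᶠ y in 𝓝 (N + s • (M - N)), 0 < D * cross (y - N) (P - N) := by
    refine ContinuousAt.eventually_lt continuousAt_const (Continuous.continuousAt (by fun_prop)) ?_
    rw [e1]; nlinarith [mul_pos hs0 hD2]
  have h2 : ∀ᶠ y in 𝓝 (N + s • (M - N)),
      D * (cross (y - N) (P - N) + cross (M - N) (y - N)) < D ^ 2 := by
    refine ContinuousAt.eventually_lt (Continuous.continuousAt (by fun_prop)) continuousAt_const ?_
    rw [e1, e2]; nlinarith [mul_pos (sub_pos.2 hs1) hD2]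
  filter_upwards [h1, h2] with y hy1 hy2 hy
  exact (mem_hull_iff h y).2 ⟨hy1.le, hy, hy2.le⟩

/-- The cone with apex `N` spanned by a triangle. -/
def cone (N : Plane) (T : Finset Plane) : Set Plane :=
  {y | ∃ t : ℝ, 0 < t ∧ N + t • (y - N) ∈ hull T}

lemma mem_cone_iff {N M P : Plane} (h : cross (M - N) (P - N) ≠ 0) (y : Plane) :
    y ∈ cone N {N, M, P} ↔
      0 ≤ cross (M - N) (P - N) * cross (y - N) (P - N) ∧
      0 ≤ cross (M - N) (P - N) * cross (M - N) (y - N) := by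
  set D := cross (M - N) (P - N) with hD
  have e1 : ∀ t : ℝ, cross (N + t • (y - N) - N) (P - N) = t * cross (y - N) (P - N) := by
    intro t; rw [cross_add_smul_left]; simp
  have e2 : ∀ t : ℝ, cross (M - N) (N + t • (y - N) - N) = t * cross (M - N) (y - N) := by
    intro t; rw [cross_add_smul_right]; simp
  constructor
  · rintro ⟨t, ht, hy⟩
    rw [mem_hull_iff h, e1, e2, ← hD] at hy
    obtain ⟨h1, h2, -⟩ := hy
    constructor
    · rw [mul_left_comm] at h1; exact nonneg_of_mul_nonneg_right h1 ht
    · rw [mul_left_comm] at h2; exact nonneg_of_mul_nonneg_right h2 ht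
  · rintro ⟨h1, h2⟩
    have hD2 : 0 < D ^ 2 := by positivity
    set a := D * cross (y - N) (P - N)
    set b := D * cross (M - N) (y - N)
    have hs : 0 < D ^ 2 + (a + b) := by positivity
    refine ⟨D ^ 2 / (D ^ 2 + (a + b)), by positivity, ?_⟩
    rw [mem_hull_iff h, e1, e2, ← hD]
    refine ⟨?_, ?_, ?_⟩
    · rw [mul_left_comm]; positivity
    · rw [mul_left_comm]; positivity
    · rw [← mul_add, mul_left_comm, mul_add, div_mul_eq_mul_div, div_le_iff₀ hs]
      nlinarith [mul_pos hD2 hD2]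

/-- The inequality for the side opposite to `N` is strict at `N`, hence harmless nearby. -/
lemma eventually_mem_hull_of_mem_cone {N M P : Plane} (h : cross (M - N) (P - N) ≠ 0) :
    ∀ᶠ y in 𝓝 N, y ∈ cone N {N, M, P} → y ∈ hull {N, M, P} := by
  have h2 : ∀ᶠ y in 𝓝 N, cross (M - N) (P - N) *
      (cross (y - N) (P - N) + cross (M - N) (y - N)) < cross (M - N) (P - N) ^ 2 := by
    refine ContinuousAt.eventually_lt (Continuous.continuousAt (by fun_prop)) continuousAt_const ?_
    simp; positivity
  filter_upwards [h2] with y hy hc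
  rw [mem_cone_iff h] at hc
  exact (mem_hull_iff h y).2 ⟨hc.1, hc.2, hy.le⟩

lemma cone_mem_nhds {N M P y : Plane} (h : cross (M - N) (P - N) ≠ 0)
    (h1 : 0 < cross (M - N) (P - N) * cross (y - N) (P - N))
    (h2 : 0 < cross (M - N) (P - N) * cross (M - N) (y - N)) : cone N {N, M, P} ∈ 𝓝 y := by
  have h1' : ∀ᶠ z in 𝓝 y, 0 < cross (M - N) (P - N) * cross (z - N) (P - N) :=
    ContinuousAt.eventually_lt continuousAt_const (Continuous.continuousAt (by fun_prop)) h1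
  have h2' : ∀ᶠ z in 𝓝 y, 0 < cross (M - N) (P - N) * cross (M - N) (z - N) :=
    ContinuousAt.eventually_lt continuousAt_const (Continuous.continuousAt (by fun_prop)) h2
  filter_upwards [h1', h2'] with z hz1 hz2
  exact (mem_cone_iff h z).2 ⟨hz1.le, hz2.le⟩

/-- The cones of two triangles on both sides of an edge cover a neighbourhood of its ray. -/
lemma cone_union_mem_nhds {N M P Q y : Plane}
    (h : cross (M - N) (P - N) * cross (M - N) (Q - N) < 0)
    (h1 : 0 < cross (M - N) (P - N) * cross (y - N) (P - N))
    (h2 : cross (M - N) (y - N) = 0) :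
    cone N {N, M, P} ∪ cone N {N, M, Q} ∈ 𝓝 y := by
  have hD : cross (M - N) (P - N) ≠ 0 := by rintro h0; rw [h0] at h; simp at h
  have hD' : cross (M - N) (Q - N) ≠ 0 := by rintro h0; rw [h0] at h; simp at h
  have h1' : ∀ᶠ z in 𝓝 y, 0 < cross (M - N) (P - N) * cross (z - N) (P - N) :=
    ContinuousAt.eventually_lt continuousAt_const (Continuous.continuousAt (by fun_prop)) h1
  -- `y - N` is a positive multiple of `M - N`, so strict positivity carries over from `P` to `Q`.
  have h3 : 0 < cross (M - N) (Q - N) * cross (y - N) (Q - N) := by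
    have e : cross (y - N) (Q - N) =
        cross (y - N) (P - N) / cross (M - N) (P - N) * cross (M - N) (Q - N) := by
      conv_lhs => rw [eq_add_cross hD y, h2]
      rw [zero_div, zero_smul, add_zero, cross_add_smul_left]; simp
    have hr : 0 < cross (y - N) (P - N) / cross (M - N) (P - N) := by
      have : cross (y - N) (P - N) / cross (M - N) (P - N)
          = cross (M - N) (P - N) * cross (y - N) (P - N) / cross (M - N) (P - N) ^ 2 := by
        field_simp
      rw [this]; positivity
    rw [e, mul_left_comm]
    exact mul_pos hr (mul_self_pos.2 hD')
  have h3' : ∀ᶠ z in 𝓝 y, 0 < cross (M - N) (Q - N) * cross (z - N) (Q - N) :=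
    ContinuousAt.eventually_lt continuousAt_const (Continuous.continuousAt (by fun_prop)) h3
  filter_upwards [h1', h3'] with z hz1 hz3
  rcases le_total 0 (cross (M - N) (P - N) * cross (M - N) (z - N)) with hc | hc
  · exact Or.inl ((mem_cone_iff hD z).2 ⟨hz1.le, hc⟩)
  · refine Or.inr ((mem_cone_iff hD' z).2 ⟨hz3.le, ?_⟩)
    rcases lt_or_gt_of_ne hD with hP | hP
    · have hQ : 0 < cross (M - N) (Q - N) := by nlinarith
      have : 0 ≤ cross (M - N) (z - N) := by nlinarith
      positivity
    · have hQ : cross (M - N) (Q - N) < 0 := by nlinarith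
      have : cross (M - N) (z - N) ≤ 0 := by nlinarith
      exact mul_nonneg_of_nonpos_of_nonpos hQ.le this

/-! ### The triangles on the two sides of an edge. -/

namespace TriMesh

variable {𝒯 : TriMesh}

/-- Two triangles on the same side of a common edge are equal. -/
lemma eq_of_same_side {N M P Q : Plane} (hT : {N, M, P} ∈ 𝒯.elems) (hT' : {N, M, Q} ∈ 𝒯.elems)
    (h : 0 < cross (M - N) (P - N) * cross (M - N) (Q - N)) :
    ({N, M, P} : Finset Plane) = {N, M, Q} := by
  have hD : cross (M - N) (P - N) ≠ 0 := by rintro h0; rw [h0] at h; simp at h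
  have hD' : cross (M - N) (Q - N) ≠ 0 := by rintro h0; rw [h0] at h; simp at h
  have h1 := eventually_mem_hull_of_edge hD (s := 1 / 2) (by norm_num) (by norm_num)
  have h2 := eventually_mem_hull_of_edge hD' (s := 1 / 2) (by norm_num) (by norm_num)
  obtain ⟨V, hV, hVo, hmV⟩ := eventually_nhds_iff.1 (h1.and h2)
  set m := N + (1 / 2 : ℝ) • (M - N) with hm
  -- A one-sided neighbourhood of the midpoint of the edge; it lies in both triangles, which
  -- distinct triangles do not allow.
  set O := V ∩ {y | 0 < cross (M - N) (P - N) * cross (M - N) (y - N)} with hO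
  have hOo : IsOpen O := hVo.inter (isOpen_lt continuous_const (by fun_prop))
  have hem : cross (M - N) (m - N) = 0 := by rw [hm, cross_add_smul_right]; simp
  have hne : O.Nonempty := by
    obtain ⟨t, ht, htV⟩ := exists_pos_add_smul_mem (hVo.mem_nhds hmV) (P - N)
    refine ⟨_, htV, ?_⟩
    rw [Set.mem_ofPred_eq, cross_add_smul_right, hem, zero_add, mul_left_comm]
    exact mul_pos ht (mul_self_pos.2 hD)
  have := mem_of_isOpen_subset hT hOo hne (fun y hy => (hV y hy.1).1 hy.2.le)
    (𝒜 := {{N, M, Q}}) (by simpa using hT') (fun y hy => by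
      simp only [Finset.mem_singleton, Set.iUnion_iUnion_eq_left]
      refine (hV y hy.1).2 ?_
      have hy2 : 0 < cross (M - N) (P - N) * cross (M - N) (y - N) := hy.2
      have h3 := mul_pos h hy2
      have h4 : 0 < cross (M - N) (P - N) ^ 2 := by positivity
      refine nonneg_of_mul_nonneg_right (a := cross (M - N) (P - N) ^ 2) ?_ h4
      linarith)
  simpa using this

lemma exists_vertices_of_pair {T : Finset Plane} {N M : Plane} (hT : T ∈ 𝒯.elems) (hNM : M ≠ N)
    (hF : {N, M} ⊆ T) : ∃ P, T = {N, M, P} ∧ P ≠ N ∧ P ≠ M ∧ cross (M - N) (P - N) ≠ 0 := by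
  obtain ⟨M', P, h1, h2, h3, h4, h5⟩ := exists_vertices hT hF (Finset.card_pair hNM.symm)
    (Finset.mem_insert_self N _)
  have : M' = M := by
    have : M' ∈ ({N, M} : Finset Plane) := by rw [h2]; simp
    simp only [Finset.mem_insert, Finset.mem_singleton] at this
    exact this.resolve_left h1
  subst this
  simp only [Finset.mem_insert, Finset.mem_singleton, not_or] at h4
  exact ⟨P, h3, h4.1, h4.2, h5⟩

lemma exists_opposite {N M P : Plane} (hT : {N, M, P} ∈ 𝒯.elems)
    (hD : cross (M - N) (P - N) ≠ 0) (hF : ¬ 𝒯.IsBoundaryEdge {N, M}) :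
    ∃ Q, {N, M, Q} ∈ 𝒯.elems ∧ cross (M - N) (P - N) * cross (M - N) (Q - N) < 0 := by
  have hNM : M ≠ N := by rintro rfl; simp at hD
  have hsub : ({N, M} : Finset Plane) ⊆ {N, M, P} := by intro x; simp; tauto
  have hE : {N, M} ∈ 𝒯.edges := mem_edges.2 ⟨_, hT, hsub, Finset.card_pair hNM.symm⟩
  have hmem : ({N, M, P} : Finset Plane) ∈ 𝒯.elems.filter fun T => {N, M} ⊆ T := by
    simp only [Finset.mem_filter]; exact ⟨hT, hsub⟩
  have hc : 1 < (𝒯.elems.filter fun T => {N, M} ⊆ T).card := by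
    have h0 := Finset.card_pos.2 ⟨_, hmem⟩
    have h1 : (𝒯.elems.filter fun T => {N, M} ⊆ T).card ≠ 1 := fun h => hF ⟨hE, h⟩
    omega
  obtain ⟨T', hT', hne⟩ := Finset.exists_mem_ne hc {N, M, P}
  rw [Finset.mem_filter] at hT'
  obtain ⟨Q, rfl, -, -, hD'⟩ := exists_vertices_of_pair hT'.1 hNM hT'.2
  refine ⟨Q, hT'.1, ?_⟩
  rcases lt_or_gt_of_ne (mul_ne_zero hD hD') with h | h
  · exact h
  · exact absurd (eq_of_same_side hT hT'.1 h).symm hne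

lemma card_elems_of_not_boundary {F : Finset Plane} (hF : F ∈ 𝒯.edges)
    (hb : ¬ 𝒯.IsBoundaryEdge F) : (𝒯.elems.filter fun T => F ⊆ T).card = 2 := by
  obtain ⟨T, hT, hFT, hc⟩ := mem_edges.1 hF
  have h0 : 0 < (𝒯.elems.filter fun T => F ⊆ T).card :=
    Finset.card_pos.2 ⟨T, Finset.mem_filter.2 ⟨hT, hFT⟩⟩
  have h1 : (𝒯.elems.filter fun T => F ⊆ T).card ≠ 1 := fun h => hb ⟨hF, h⟩
  have h2 : (𝒯.elems.filter fun T => F ⊆ T).card ≤ 2 := by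
    obtain ⟨N, M, hNM, rfl⟩ := Finset.card_eq_two.1 hc
    -- The side of the edge on which a triangle lies determines the triangle, and there are two
    -- sides.
    have := Finset.card_le_card_of_injOn (s := 𝒯.elems.filter fun T => {N, M} ⊆ T)
      (t := (Finset.univ : Finset Bool)) (fun T => decide (∃ P ∈ T, 0 < cross (M - N) (P - N)))
      (fun _ _ => Finset.mem_coe.2 (Finset.mem_univ _)) (by
        intro T hT T' hT' he
        simp only [Finset.coe_filter, Set.mem_ofPred_eq] at hT hT'
        obtain ⟨P, rfl, -, -, hD⟩ := exists_vertices_of_pair hT.1 hNM.symm hT.2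
        obtain ⟨Q, rfl, -, -, hD'⟩ := exists_vertices_of_pair hT'.1 hNM.symm hT'.2
        simp only [Finset.mem_insert, Finset.mem_singleton, exists_eq_or_imp, exists_eq_left,
          sub_self, cross_zero_right, cross_self, lt_irrefl, false_or, decide_eq_decide] at he
        refine eq_of_same_side hT.1 hT'.1 ?_
        rcases lt_or_gt_of_ne hD with h | h
        · have : cross (M - N) (Q - N) < 0 :=
            lt_of_le_of_ne (not_lt.1 fun h' => lt_asymm h (he.2 h')) hD'
          exact mul_pos_of_neg_of_neg h this
        · exact mul_pos h (he.1 h))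
    simpa using this
  omega

/-! ### Sets of edges at a node closed under passing through triangles. -/

/-- A set of edges at the node `N` which contains with one edge of a triangle also its other edge
at `N`. -/
structure IsLinkClosed (𝒯 : TriMesh) (N : Plane) (K : Finset (Finset Plane)) : Prop where
  mem_edges : ∀ F ∈ K, F ∈ 𝒯.edges
  mem : ∀ F ∈ K, N ∈ F
  closed : ∀ T ∈ 𝒯.elems, ∀ F ∈ K, F ⊆ T → ∀ F', F' ⊆ T → F'.card = 2 → N ∈ F' → F' ∈ K

lemma edges_at_vertex {N M P : Plane} (hD : cross (M - N) (P - N) ≠ 0) {F : Finset Plane}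
    (hF : F ⊆ {N, M, P}) (hc : F.card = 2) (hN : N ∈ F) : F = {N, M} ∨ F = {N, P} := by
  obtain ⟨X, hX⟩ : ∃ X, F.erase N = {X} := Finset.card_eq_one.1 (by
    rw [Finset.card_erase_of_mem hN, hc])
  have hXF : X ∈ F.erase N := by rw [hX]; simp
  have hFe : F = {N, X} := by rw [← Finset.insert_erase hN, hX]
  rw [Finset.mem_erase] at hXF
  have := hF hXF.2
  simp only [Finset.mem_insert, Finset.mem_singleton] at this
  rcases this with h | rfl | rfl
  · exact absurd h hXF.1
  · exact Or.inl hFe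
  · exact Or.inr hFe

namespace IsLinkClosed

variable {N : Plane} {K : Finset (Finset Plane)}

/-- The number of boundary edges is even. -/
lemma even_card_boundary (hK : 𝒯.IsLinkClosed N K) :
    Even (K.filter fun F => 𝒯.IsBoundaryEdge F).card := by
  -- A triangle contains none or two of the edges in `K`. Counting incidences edge by edge instead,
  -- a boundary edge contributes one and an inner edge two.
  have h1 : ∀ T ∈ 𝒯.elems, Even (K.filter fun F => F ⊆ T).card := by
    intro T hT
    by_cases h : ∃ F ∈ K, F ⊆ T
    · obtain ⟨F, hF, hFT⟩ := h
      obtain ⟨M, P, hMN, rfl, rfl, hP, hD⟩ := exists_vertices hT hFT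
        (card_edge (hK.mem_edges F hF)) (hK.mem F hF)
      simp only [Finset.mem_insert, Finset.mem_singleton, not_or] at hP
      have : (K.filter fun F => F ⊆ {N, M, P}) = {{N, M}, {N, P}} := by
        ext F'
        simp only [Finset.mem_filter, Finset.mem_insert, Finset.mem_singleton]
        constructor
        · rintro ⟨h1, h2⟩
          exact edges_at_vertex hD h2 (card_edge (hK.mem_edges F' h1)) (hK.mem F' h1)
        · rintro (rfl | rfl)
          · exact ⟨hF, hFT⟩
          · have : ({N, P} : Finset Plane) ⊆ {N, M, P} := by intro x; simp; tauto
            exact ⟨hK.closed _ hT _ hF hFT _ this (Finset.card_pair (Ne.symm hP.1)) (by simp), this⟩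
      rw [this, Finset.card_pair]
      · exact even_two
      · intro h
        have : P ∈ ({N, M} : Finset Plane) := by rw [h]; simp
        simp only [Finset.mem_insert, Finset.mem_singleton] at this
        tauto
    · rw [Finset.filter_false_of_mem (by push Not at h; exact h)]; simp
  have h2 : ∑ T ∈ 𝒯.elems, (K.filter fun F => F ⊆ T).card
      = ∑ F ∈ K, (𝒯.elems.filter fun T => F ⊆ T).card := by
    simp only [Finset.card_filter]
    exact Finset.sum_comm
  have h3 : Even (∑ F ∈ K, (𝒯.elems.filter fun T => F ⊆ T).card) := by
    rw [← h2]; exact Finset.even_sum _ h1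
  rw [← Finset.sum_filter_add_sum_filter_not K (fun F => 𝒯.IsBoundaryEdge F)] at h3
  rw [Finset.sum_congr rfl (g := fun _ => 1) (by
      intro F hF; exact (Finset.mem_filter.1 hF).2.2)] at h3
  rw [Finset.sum_congr (s₁ := K.filter fun F => ¬ 𝒯.IsBoundaryEdge F) rfl (g := fun _ => 2) (by
      intro F hF
      rw [Finset.mem_filter] at hF
      exact card_elems_of_not_boundary (hK.mem_edges F hF.1) hF.2)] at h3
  simpa [Nat.even_add] using h3

/-- The cones of the triangles at a closed set of inner edges cover the plane. -/
lemma mem_cone (hK : 𝒯.IsLinkClosed N K) (hne : K.Nonempty)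
    (hb : ∀ F ∈ K, ¬ 𝒯.IsBoundaryEdge F) {y : Plane} (hy : y ≠ N) :
    ∃ T ∈ 𝒯.elems, (∃ F ∈ K, F ⊆ T) ∧ y ∈ cone N T := by
  set 𝒜 := 𝒯.elems.filter fun T => ∃ F ∈ K, F ⊆ T with h𝒜
  set U : Set Plane := ⋃ T ∈ 𝒜, cone N T with hU
  have hvert : ∀ T ∈ 𝒜, ∃ M P, T = {N, M, P} ∧ {N, M} ∈ K ∧ {N, P} ∈ K ∧
      cross (M - N) (P - N) ≠ 0 := by
    intro T hT
    obtain ⟨hT, F, hF, hFT⟩ := Finset.mem_filter.1 hT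
    obtain ⟨M, P, hMN, rfl, rfl, hP, hD⟩ := exists_vertices hT hFT
      (card_edge (hK.mem_edges F hF)) (hK.mem F hF)
    simp only [Finset.mem_insert, Finset.mem_singleton, not_or] at hP
    refine ⟨M, P, rfl, hF, ?_, hD⟩
    exact hK.closed _ hT _ hF hFT _ (by intro x; simp; tauto) (Finset.card_pair (Ne.symm hP.1))
      (by simp)
  have hclosed : IsClosed U := by
    refine Set.Finite.isClosed_biUnion 𝒜.finite_toSet ?_
    intro T hT
    obtain ⟨M, P, rfl, -, -, hD⟩ := hvert T hT
    have : cone N {N, M, P} = {y | 0 ≤ cross (M - N) (P - N) * cross (y - N) (P - N)} ∩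
        {y | 0 ≤ cross (M - N) (P - N) * cross (M - N) (y - N)} := by
      ext y; exact mem_cone_iff hD y
    rw [this]
    exact (isClosed_le continuous_const (by fun_prop)).inter
      (isClosed_le continuous_const (by fun_prop))
  -- a point on the ray through an edge is an inner point
  have hray : ∀ M P y, {N, M, P} ∈ 𝒯.elems → {N, M} ∈ K →
      0 < cross (M - N) (P - N) * cross (y - N) (P - N) → cross (M - N) (y - N) = 0 →
      U ∈ 𝓝 y := by
    intro M P y hT hF h1 h2
    have hD : cross (M - N) (P - N) ≠ 0 := by rintro h0; rw [h0] at h1; simp at h1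
    obtain ⟨Q, hQ, hPQ⟩ := exists_opposite hT hD (hb _ hF)
    refine Filter.mem_of_superset (cone_union_mem_nhds hPQ h1 h2) ?_
    refine Set.union_subset ?_ ?_
    · exact Set.subset_biUnion_of_mem (u := fun T => cone N T)
        (Finset.mem_filter.2 ⟨hT, _, hF, by intro x; simp; tauto⟩)
    · exact Set.subset_biUnion_of_mem (u := fun T => cone N T)
        (Finset.mem_filter.2 ⟨hQ, _, hF, by intro x; simp; tauto⟩)
  -- If both cone inequalities are equalities then `y = N`; if one is, then `y` is on the ray of an
  -- edge, where the two adjacent cones fit together; otherwise `y` is inside a cone.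
  have hopen : ∀ y ∈ U, y ≠ N → U ∈ 𝓝 y := by
    intro y hy hyN
    obtain ⟨T, hTA, hyT⟩ := Set.mem_iUnion₂.1 hy
    obtain ⟨M, P, rfl, hFM, hFP, hD⟩ := hvert T hTA
    have hT := (Finset.mem_filter.1 hTA).1
    obtain ⟨h1, h2⟩ := (mem_cone_iff hD y).1 hyT
    rcases h1.eq_or_lt with h1 | h1
    · have h1' : cross (y - N) (P - N) = 0 := by
        rcases mul_eq_zero.1 h1.symm with h | h
        · exact absurd h hD
        · exact h
      rcases h2.eq_or_lt with h2 | h2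
      · have h2' : cross (M - N) (y - N) = 0 := by
          rcases mul_eq_zero.1 h2.symm with h | h
          · exact absurd h hD
          · exact h
        exact absurd (by simpa [h1', h2'] using eq_add_cross hD y) hyN
      · refine hray P M y ?_ hFP ?_ ?_
        · rwa [show ({N, P, M} : Finset Plane) = {N, M, P} by ext x; simp; tauto]
        · rw [cross_swap (M - N), cross_swap (M - N)]; linarith
        · rw [cross_swap, h1', neg_zero]
    · rcases h2.eq_or_lt with h2 | h2
      · refine hray M P y hT hFM h1 ?_
        rcases mul_eq_zero.1 h2.symm with h | h
        · exact absurd h hD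
        · exact h
      · exact Filter.mem_of_superset (cone_mem_nhds hD h1 h2)
          (Set.subset_biUnion_of_mem (u := fun T => cone N T) hTA)
  -- Away from `N` the union of the cones is both open and closed, and the punctured plane is
  -- connected.
  have hconn : IsPreconnected ({N}ᶜ : Set Plane) :=
    (isConnected_compl_singleton_of_one_lt_rank
      (by rw [← Module.finrank_eq_rank]; simp) N).isPreconnected
  have hsub : ({N}ᶜ : Set Plane) ⊆ interior U := by
    refine hconn.subset_left_of_subset_union isOpen_interior hclosed.isOpen_compl ?_ ?_ ?_
    · exact disjoint_compl_right.mono_left interior_subset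
    · intro y hy
      by_cases h : y ∈ U
      · exact Or.inl (mem_interior_iff_mem_nhds.2 (hopen y h hy))
      · exact Or.inr h
    · obtain ⟨F, hF⟩ := hne
      obtain ⟨T, hT, hFT, hc⟩ := TriMesh.mem_edges.1 (hK.mem_edges F hF)
      obtain ⟨M, P, hMN, rfl, rfl, hP, hD⟩ := exists_vertices hT hFT hc (hK.mem F hF)
      refine ⟨M, hMN, mem_interior_iff_mem_nhds.2 (hopen M ?_ hMN)⟩
      refine Set.mem_iUnion₂.2 ⟨_, Finset.mem_filter.2 ⟨hT, _, hF, hFT⟩, 1, one_pos, ?_⟩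
      simpa using mem_hull_of_mem (by simp)
  obtain ⟨T, hT, hyT⟩ := Set.mem_iUnion₂.1 (interior_subset (hsub hy))
  rw [h𝒜, Finset.mem_filter] at hT
  exact ⟨T, hT.1, hT.2, hyT⟩

/-- The finitely many cones, which cover the plane, lie inside their triangles close to `N`. -/
lemma iUnion_hull_mem_nhds (hK : 𝒯.IsLinkClosed N K) (hne : K.Nonempty)
    (hb : ∀ F ∈ K, ¬ 𝒯.IsBoundaryEdge F) :
    (⋃ T ∈ 𝒯.elems.filter fun T => ∃ F ∈ K, F ⊆ T, hull T) ∈ 𝓝 N := by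
  have h1 : ∀ᶠ y in 𝓝 N, ∀ T ∈ 𝒯.elems.filter fun T => ∃ F ∈ K, F ⊆ T,
      y ∈ cone N T → y ∈ hull T := by
    rw [Filter.eventually_all_finset]
    intro T hT
    obtain ⟨hT, F, hF, hFT⟩ := Finset.mem_filter.1 hT
    obtain ⟨M, P, hMN, rfl, rfl, hP, hD⟩ := exists_vertices hT hFT
      (card_edge (hK.mem_edges F hF)) (hK.mem F hF)
    exact eventually_mem_hull_of_mem_cone hD
  filter_upwards [h1] with y hy
  by_cases hyN : y = N
  · obtain ⟨F, hF⟩ := hne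
    obtain ⟨T, hT, hFT, hc⟩ := TriMesh.mem_edges.1 (hK.mem_edges F hF)
    exact Set.mem_iUnion₂.2 ⟨T, Finset.mem_filter.2 ⟨hT, F, hF, hFT⟩,
      hyN ▸ mem_hull_of_mem (hFT (hK.mem F hF))⟩
  · obtain ⟨T, hT, hTK, hyT⟩ := hK.mem_cone hne hb hyN
    have hTA : T ∈ 𝒯.elems.filter fun T => ∃ F ∈ K, F ⊆ T := Finset.mem_filter.2 ⟨hT, hTK⟩
    exact Set.mem_iUnion₂.2 ⟨T, hTA, hy T hTA hyT⟩

/-- The triangles at `K` already fill a neighbourhood of `N`. Any triangle at `N` has interior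
points there, so it is one of them, and closedness supplies its edges. -/
lemma mem_of_no_boundary (hK : 𝒯.IsLinkClosed N K) (hne : K.Nonempty)
    (hb : ∀ F ∈ K, ¬ 𝒯.IsBoundaryEdge F) {F : Finset Plane} (hF : F ∈ 𝒯.edges) (hN : N ∈ F) :
    F ∈ K := by
  obtain ⟨T, hT, hFT, hc⟩ := TriMesh.mem_edges.1 hF
  have hnhds := hK.iUnion_hull_mem_nhds hne hb
  obtain ⟨V, hV, hVo, hNV⟩ := mem_nhds_iff.1 hnhds
  have hNc : N ∈ closure (interior (hull T)) := by
    rw [closure_interior_hull hT]; exact mem_hull_of_mem (hFT hN)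
  have hTA := mem_of_isOpen_subset hT (hVo.inter isOpen_interior)
    (mem_closure_iff.1 hNc V hVo hNV) (Set.inter_subset_right.trans interior_subset)
    (Finset.filter_subset _ _) (Set.inter_subset_left.trans hV)
  obtain ⟨-, F', hF', hFT'⟩ := Finset.mem_filter.1 hTA
  exact hK.closed T hT F' hF' hFT' F hFT hc hN

/-- If the boundary has no pinch points, a closed set consists of all edges at the node. -/
lemma mem_of_simpleBoundary (hK : 𝒯.IsLinkClosed N K) (hne : K.Nonempty)
    (hs : 𝒯.SimpleBoundary) {F : Finset Plane} (hF : F ∈ 𝒯.edges) (hN : N ∈ F) : F ∈ K := by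
  by_contra hFK
  -- The complement is again closed. If both sets are nonempty, neither can be free of boundary
  -- edges; by parity each has at least two, four in total at `N`.
  set K' := 𝒯.edges.filter fun F => N ∈ F ∧ F ∉ K with hK'
  have hK'c : 𝒯.IsLinkClosed N K' := by
    refine ⟨fun F hF => (Finset.mem_filter.1 hF).1, fun F hF => (Finset.mem_filter.1 hF).2.1, ?_⟩
    intro T hT F hF hFT F' hF'T hc hN'
    obtain ⟨h1, h2, h3⟩ := Finset.mem_filter.1 hF
    refine Finset.mem_filter.2 ⟨TriMesh.mem_edges.2 ⟨T, hT, hF'T, hc⟩, hN', fun h => h3 ?_⟩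
    exact hK.closed T hT F' h hF'T F hFT (card_edge h1) h2
  have hFK' : F ∈ K' := Finset.mem_filter.2 ⟨hF, hN, hFK⟩
  have h1 : 1 ≤ (K.filter fun F => 𝒯.IsBoundaryEdge F).card := by
    by_contra! hc
    have h0 : (K.filter fun F => 𝒯.IsBoundaryEdge F) = ∅ := Finset.card_eq_zero.1 (by omega)
    rw [Finset.filter_eq_empty_iff] at h0
    exact hFK (hK.mem_of_no_boundary hne (fun F hF => h0 hF) hF hN)
  have h2 : 1 ≤ (K'.filter fun F => 𝒯.IsBoundaryEdge F).card := by
    by_contra! hc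
    have h0 : (K'.filter fun F => 𝒯.IsBoundaryEdge F) = ∅ := Finset.card_eq_zero.1 (by omega)
    rw [Finset.filter_eq_empty_iff] at h0
    obtain ⟨G, hG⟩ := hne
    have := hK'c.mem_of_no_boundary ⟨F, hFK'⟩ (fun F hF => h0 hF) (hK.mem_edges G hG) (hK.mem G hG)
    exact (Finset.mem_filter.1 this).2.2 hG
  obtain ⟨a, ha⟩ := hK.even_card_boundary
  obtain ⟨b, hb⟩ := hK'c.even_card_boundary
  have hdisj : Disjoint (K.filter fun F => 𝒯.IsBoundaryEdge F)
      (K'.filter fun F => 𝒯.IsBoundaryEdge F) := by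
    rw [Finset.disjoint_left]
    intro G hG hG'
    exact (Finset.mem_filter.1 (Finset.mem_filter.1 hG').1).2.2 (Finset.mem_filter.1 hG).1
  have hle : ((K.filter fun F => 𝒯.IsBoundaryEdge F) ∪
      (K'.filter fun F => 𝒯.IsBoundaryEdge F)).card ≤ 2 := by
    obtain ⟨T, hT, hFT, hc⟩ := TriMesh.mem_edges.1 hF
    refine (Finset.card_le_card ?_).trans (hs N (Finset.mem_biUnion.2 ⟨T, hT, hFT hN⟩))
    intro G hG
    rw [Finset.mem_union, Finset.mem_filter, Finset.mem_filter] at hG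
    rcases hG with ⟨h, h'⟩ | ⟨h, h'⟩
    · exact Finset.mem_filter.2 ⟨h'.1, h', hK.mem G h⟩
    · exact Finset.mem_filter.2 ⟨h'.1, h', hK'c.mem G h⟩
  rw [Finset.card_union_of_disjoint hdisj] at hle
  omega

end IsLinkClosed
end TriMesh
-- Uniform bounds for solvable linear systems.
-- The solution is chosen linearly in `g`, by a right inverse of the matrix on its range, extended
-- to the whole space; Cauchy–Schwarz then gives `C` from the entries of that linear map.
lemma exists_solution_bound_of_matrix {m k : ℕ} (A : Fin m → Fin k → ℝ) :
    ∃ C : ℝ, 0 < C ∧ ∀ g : Fin m → ℝ,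
      (∀ l : Fin m → ℝ, (∀ j, ∑ i, l i * A i j = 0) → ∑ i, l i * g i = 0) →
      ∃ x : Fin k → ℝ, (∀ i, ∑ j, A i j * x j = g i) ∧ ∀ j, x j ^ 2 ≤ C * ∑ i, g i ^ 2 := by
  set L : (Fin k → ℝ) →ₗ[ℝ] (Fin m → ℝ) := Matrix.mulVecLin (Matrix.of A) with hL
  have hLa : ∀ x i, L x i = ∑ j, A i j * x j := by
    intro x i; simp [hL, Matrix.mulVec, dotProduct]
  obtain ⟨R, hR⟩ := L.rangeRestrict.exists_rightInverse_of_surjective L.range_rangeRestrict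
  obtain ⟨B, hB⟩ := LinearMap.exists_extend R
  refine ⟨∑ i, ∑ j, B (Pi.single i 1) j ^ 2 + 1,
    add_pos_of_nonneg_of_pos (by positivity) one_pos, fun g hg => ⟨B g, ?_, ?_⟩⟩
  · have hgr : g ∈ LinearMap.range L := by
      -- A functional that vanishes on the range but not at `g` would be a left null vector not
      -- orthogonal to `g`.
      by_contra hn
      obtain ⟨f, hf, hker⟩ := Submodule.exists_le_ker_of_notMem hn
      have hfs : ∀ y, f y = ∑ i, f (Pi.single i 1) * y i := by
        intro y
        rw [LinearMap.pi_apply_eq_sum_univ f y]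
        refine Finset.sum_congr rfl fun i _ => ?_
        rw [smul_eq_mul, mul_comm]
        congr 2
        ext j; simp [Pi.single_apply, eq_comm]
      refine hf ?_
      rw [hfs]
      refine hg _ fun j => ?_
      have h0 : f (L (Pi.single j 1)) = 0 := hker ⟨_, rfl⟩
      rw [hfs] at h0
      rw [← h0]
      refine Finset.sum_congr rfl fun i _ => ?_
      rw [hLa]; simp [Pi.single_apply]
    intro i
    rw [← hLa]
    have h1 : B g = R ⟨g, hgr⟩ := by rw [← hB]; rfl
    have h2 := congrArg Subtype.val (LinearMap.congr_fun hR ⟨g, hgr⟩)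
    rw [h1]
    exact congrFun h2 i
  · intro j
    have h1 : B g j = ∑ i, g i * B (Pi.single i 1) j := by
      rw [LinearMap.pi_apply_eq_sum_univ B g, Finset.sum_apply]
      refine Finset.sum_congr rfl fun i _ => ?_
      rw [Pi.smul_apply, smul_eq_mul]
      have : (fun j => if i = j then (1 : ℝ) else 0) = Pi.single i 1 := by
        ext j; simp [Pi.single_apply, eq_comm]
      rw [this]
    rw [h1]
    refine (Finset.sum_mul_sq_le_sq_mul_sq _ _ _).trans ?_
    rw [mul_comm]
    refine mul_le_mul_of_nonneg_right ?_ (by positivity)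
    have : ∑ i, B (Pi.single i 1) j ^ 2 ≤ ∑ i, ∑ j, B (Pi.single i 1) j ^ 2 :=
      Finset.sum_le_sum fun i _ => Finset.single_le_sum (f := fun j => B (Pi.single i 1) j ^ 2)
        (fun _ _ => sq_nonneg _) (Finset.mem_univ j)
    linarith

/-- Solvable linear systems of bounded size with coefficients in `{-1, 0, 1}` have uniformly
bounded solutions. -/
lemma exists_uniform_solution_bound (n : ℕ) :
    ∃ C : ℝ, 0 < C ∧ ∀ (ι κ : Type) [Fintype ι] [Fintype κ], Fintype.card ι ≤ n →
      Fintype.card κ ≤ n → ∀ A : ι → κ → ℝ, (∀ i j, ((SignType.sign (A i j) : SignType) : ℝ) = A i j) →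
      ∀ g : ι → ℝ, (∀ l : ι → ℝ, (∀ j, ∑ i, l i * A i j = 0) → ∑ i, l i * g i = 0) →
      ∃ x : κ → ℝ, (∀ i, ∑ j, A i j * x j = g i) ∧ ∀ j, x j ^ 2 ≤ C * ∑ i, g i ^ 2 := by
  -- Entries in `SignType` leave finitely many matrices of each size, so the constants of all sizes
  -- up to `n` can be added up.
  choose C hC0 hC using fun (m k : ℕ) (A : Fin m → Fin k → SignType) =>
    exists_solution_bound_of_matrix (fun i j => (A i j : ℝ))
  refine ⟨∑ m ∈ Finset.range (n + 1), ∑ k ∈ Finset.range (n + 1), ∑ A, C m k A, ?_, ?_⟩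
  · refine Finset.sum_pos (fun m _ => Finset.sum_pos (fun k _ => Finset.sum_pos (fun A _ => hC0 m k A)
      ⟨fun _ _ => 0, Finset.mem_univ _⟩) ⟨0, by simp⟩) ⟨0, by simp⟩
  intro ι κ _ _ hι hκ A hA g hg
  set e := Fintype.equivFin ι
  set f := Fintype.equivFin κ
  set A' : Fin (Fintype.card ι) → Fin (Fintype.card κ) → SignType :=
    fun i j => SignType.sign (A (e.symm i) (f.symm j)) with hA'
  have hAA : ∀ i j, ((A' i j : SignType) : ℝ) = A (e.symm i) (f.symm j) := fun i j => hA _ _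
  have hle : C _ _ A' ≤ ∑ m ∈ Finset.range (n + 1), ∑ k ∈ Finset.range (n + 1), ∑ A, C m k A := by
    refine (Finset.single_le_sum (f := fun A => C _ _ A) (fun A _ => (hC0 _ _ A).le)
      (Finset.mem_univ A')).trans ?_
    refine (Finset.single_le_sum (f := fun k => ∑ A, C _ k A)
      (fun k _ => Finset.sum_nonneg fun A _ => (hC0 _ _ A).le)
      (Finset.mem_range.2 (Nat.lt_succ_of_le hκ))).trans ?_
    exact Finset.single_le_sum (f := fun m => ∑ k ∈ Finset.range (n + 1), ∑ A, C m k A)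
      (fun m _ => Finset.sum_nonneg fun k _ => Finset.sum_nonneg fun A _ => (hC0 _ _ A).le)
      (Finset.mem_range.2 (Nat.lt_succ_of_le hι))
  obtain ⟨x, hx1, hx2⟩ := hC _ _ A' (fun i => g (e.symm i)) (by
    intro l hl
    have := hg (fun i => l (e i)) (fun j => by
      have := hl (f j)
      rw [← this, ← e.sum_comp]
      simp [hAA])
    rw [← this, ← e.sum_comp]
    simp)
  refine ⟨fun j => x (f j), fun i => ?_, fun j => ?_⟩
  · have := hx1 (e i)
    rw [← f.sum_comp] at this
    simpa [hAA] using this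
  · refine (hx2 (f j)).trans ?_
    rw [← e.sum_comp]
    simp only [Equiv.symm_apply_apply]
    exact mul_le_mul_of_nonneg_right hle (by positivity)

/-! ### Boundary edges and the open domain. -/

namespace TriMesh

variable {𝒯 : TriMesh}

lemma isClosed_iUnion_hull (𝒜 : Finset (Finset Plane)) : IsClosed (⋃ T ∈ 𝒜, hull T) :=
  Set.Finite.isClosed_biUnion 𝒜.finite_toSet fun T _ => (isCompact_hull T).isClosed

lemma interior_hull_subset_domain {T : Finset Plane} (hT : T ∈ 𝒯.elems) :
    interior (hull T) ⊆ 𝒯.domain :=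
  interior_mono (Set.subset_biUnion_of_mem (u := fun T => hull T) hT)

lemma closure_domain : closure 𝒯.domain = ⋃ T ∈ 𝒯.elems, hull T := by
  apply subset_antisymm
  · exact closure_minimal interior_subset (isClosed_iUnion_hull _)
  · refine Set.iUnion₂_subset fun T hT => ?_
    rw [← closure_interior_hull hT]
    exact closure_mono (interior_hull_subset_domain hT)

/-- A boundary edge does not meet the (open) domain. -/
lemma disjoint_boundary_domain {F : Finset Plane} (hF : 𝒯.IsBoundaryEdge F) :
    Disjoint (hull F) 𝒯.domain := by
  rw [Set.disjoint_left]
  intro x hxF hxd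
  obtain ⟨T, hT, hFT, hc⟩ := mem_edges.1 hF.1
  obtain ⟨N, hN⟩ : F.Nonempty := Finset.card_pos.1 (by omega)
  obtain ⟨M, P, hMN, rfl, hTe, hP, hD⟩ := exists_vertices hT hFT hc hN
  have hdo : IsOpen 𝒯.domain := isOpen_interior
  -- The domain is open, so the point can be moved off the endpoints of the edge.
  obtain ⟨s, hs, hsd⟩ : ∃ s ∈ Set.Ioo (0 : ℝ) 1, N + s • (M - N) ∈ 𝒯.domain := by
    rw [hull_pair, segment_eq_image'] at hxF
    obtain ⟨s, hs, rfl⟩ := hxF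
    rw [← closure_Ioo zero_ne_one] at hs
    obtain ⟨s', h1, h2⟩ := mem_closure_iff.1 hs ((fun s : ℝ => N + s • (M - N)) ⁻¹' 𝒯.domain)
      (hdo.preimage (by fun_prop)) hxd
    exact ⟨s', h2, h1⟩
  set x' := N + s • (M - N) with hx'
  have hx'F : x' ∈ hull {N, M} := by
    rw [hull_pair, segment_eq_image']
    exact ⟨s, ⟨hs.1.le, hs.2.le⟩, rfl⟩
  -- Otherwise a small step away from `P` would stay in the domain, avoid all other triangles, and
  -- leave `T`.
  have hZ : x' ∈ ⋃ T' ∈ 𝒯.elems.erase T, hull T' := by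
    by_contra hZ
    obtain ⟨t, ht, htU⟩ := exists_pos_add_smul_mem (Filter.inter_mem (hdo.mem_nhds hsd)
      ((isClosed_iUnion_hull (𝒯.elems.erase T)).isOpen_compl.mem_nhds hZ)) (-(P - N))
    obtain ⟨T', hT', hyT'⟩ := Set.mem_iUnion₂.1 (interior_subset htU.1)
    have hTT' : T' = T := by
      by_contra hne
      exact htU.2 (Set.mem_iUnion₂.2 ⟨T', Finset.mem_erase.2 ⟨hne, hT'⟩, hyT'⟩)
    rw [hTT', hTe, mem_hull_iff hD] at hyT'
    have h2 := hyT'.2.1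
    have e : cross (M - N) (x' - N) = 0 := by rw [hx', cross_add_smul_right]; simp
    have e' : cross (M - N) (-(P - N)) = - cross (M - N) (P - N) := by simp [cross]; ring
    rw [cross_add_smul_right, e, e'] at h2
    nlinarith [mul_pos ht (mul_self_pos.2 hD)]
  obtain ⟨T', hT', hxT'⟩ := Set.mem_iUnion₂.1 hZ
  rw [Finset.mem_erase] at hT'
  have hnot : ¬ ({N, M} : Finset Plane) ⊆ T' := by
    intro hsub
    obtain ⟨T₀, hT₀⟩ := Finset.card_eq_one.1 hF.2
    have h1 : T ∈ ({T₀} : Finset (Finset Plane)) := by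
      rw [← hT₀]; exact Finset.mem_filter.2 ⟨hT, hFT⟩
    have h2 : T' ∈ ({T₀} : Finset (Finset Plane)) := by
      rw [← hT₀]; exact Finset.mem_filter.2 ⟨hT'.2, hsub⟩
    rw [Finset.mem_singleton] at h1 h2
    exact hT'.1 (h2.trans h1.symm)
  -- The second triangle contains at most one endpoint of the edge, so `x'` would have to be that
  -- endpoint.
  have hmem : x' ∈ hull ({N, M} ∩ (T ∩ T')) := by
    rw [hull, Finset.coe_inter, (𝒯.indep T hT).convexHull_inter (by exact_mod_cast hFT)
      (by exact_mod_cast Finset.inter_subset_left)]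
    refine ⟨hx'F, ?_⟩
    change x' ∈ hull (T ∩ T')
    rw [← 𝒯.conforming T hT T' hT'.2]
    exact ⟨hull_mono hFT hx'F, hxT'⟩
  have hsingle : ∀ a : Plane, ({N, M} ∩ (T ∩ T') : Finset Plane) ⊆ {a} → x' = a := by
    intro a ha
    have := hull_mono ha hmem
    simpa [hull] using this
  have hMN' : M - N ≠ 0 := sub_ne_zero.2 hMN
  by_cases hNT : N ∈ T'
  · have hMT : M ∉ T' := fun h => hnot (by
      intro z hz
      simp only [Finset.mem_insert, Finset.mem_singleton] at hz
      rcases hz with rfl | rfl <;> assumption)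
    have h := hsingle N (by
      intro z hz
      simp only [Finset.mem_inter, Finset.mem_insert, Finset.mem_singleton] at hz ⊢
      rcases hz.1 with h | rfl
      · exact h
      · exact absurd hz.2.2 hMT)
    rw [hx'] at h
    have : s • (M - N) = 0 := by simpa using h
    rcases smul_eq_zero.1 this with h | h
    · exact hs.1.ne' h
    · exact hMN' h
  · have h := hsingle M (by
      intro z hz
      simp only [Finset.mem_inter, Finset.mem_insert, Finset.mem_singleton] at hz ⊢
      rcases hz.1 with rfl | h
      · exact absurd hz.2.2 hNT
      · exact h)
    have : (1 - s) • (M - N) = 0 := by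
      rw [sub_smul, one_smul, sub_eq_zero, ← sub_eq_iff_eq_add'.2 (hx'.symm.trans h).symm]
    rcases smul_eq_zero.1 this with h | h
    · linarith [hs.2]
    · exact hMN' h

end TriMesh

/-! ### Solvability at a node: incidence numbers, signs and the constraint. -/

namespace CutMesh

variable {𝒯 : CutMesh}

lemma closure_sub_subset (i : Fin 2) : closure (𝒯.sub i) ⊆ closure 𝒯.domain := by
  rw [𝒯.closure_sub]
  fin_cases i
  · exact Set.subset_union_left
  · exact Set.subset_union_right

lemma sub_subset_domain (i : Fin 2) : 𝒯.sub i ⊆ 𝒯.domain := by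
  refine interior_maximal ?_ (𝒯.isOpen_sub i)
  rw [← TriMesh.closure_domain]
  exact subset_closure.trans (closure_sub_subset i)

lemma not_boundary_of_meets {F : Finset Plane} {i : Fin 2} (h : (hull F ∩ 𝒯.sub i).Nonempty) :
    ¬ 𝒯.IsBoundaryEdge F := by
  intro hb
  obtain ⟨x, hx, hxi⟩ := h
  exact Set.disjoint_left.1 (TriMesh.disjoint_boundary_domain hb) hx (sub_subset_domain i hxi)

/-- The triangle is the closure of its interior, so it has interior points in `V`; these are limits
of points of the subdomain. -/
lemma mem_subElems_of_mem_closure {T : Finset Plane} (hT : T ∈ 𝒯.elems) {i : Fin 2} {x : Plane}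
    (hx : x ∈ hull T) {V : Set Plane} (hV : V ∈ 𝓝 x) (h : V ∩ interior (hull T) ⊆ closure (𝒯.sub i)) :
    T ∈ 𝒯.subElems i := by
  rw [← TriMesh.closure_interior_hull hT] at hx
  obtain ⟨V', hV', hVo, hxV⟩ := mem_nhds_iff.1 hV
  obtain ⟨y, hyV, hyT⟩ := mem_closure_iff.1 hx V' hVo hxV
  obtain ⟨z, hz, hzi⟩ := mem_closure_iff.1 (h ⟨hV' hyV, hyT⟩) _ isOpen_interior hyT
  exact Finset.mem_filter.2 ⟨hT, z, interior_subset hz, hzi⟩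

/-- Both triangles at an edge of `ℱ_h^i` belong to `𝒯_h^i`. -/
lemma mem_subElems_of_subset {c : BoundaryEdges} {i : Fin 2} {F T : Finset Plane}
    (hF : F ∈ 𝒯.subEdges c i) (hT : T ∈ 𝒯.elems) (hFT : F ⊆ T) : T ∈ 𝒯.subElems i := by
  obtain ⟨hFe, h | ⟨-, hb, x, hxF, hxi, hxΓ⟩⟩ := Finset.mem_filter.1 hF
  · obtain ⟨x, hxF, hxi⟩ := h
    exact Finset.mem_filter.2 ⟨hT, x, hull_mono hFT hxF, hxi⟩
  · obtain ⟨j, hji, hdom, hΓ⟩ : ∃ j, j ≠ i ∧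
        closure 𝒯.domain = closure (𝒯.sub i) ∪ closure (𝒯.sub j) ∧
        𝒯.Γ = frontier (𝒯.sub i) ∩ frontier (𝒯.sub j) := by
      fin_cases i
      · exact ⟨1, by decide, 𝒯.closure_sub, rfl⟩
      · exact ⟨0, by decide, by rw [Set.union_comm]; exact 𝒯.closure_sub,
          by rw [Set.inter_comm]; rfl⟩
    -- A boundary edge misses both open subdomains, so a point of `∂Ω^i` off `Γ` stays away from the
    -- other subdomain, and nearby the domain lies in the closure of `Ω^i`.
    have hxj : x ∉ closure (𝒯.sub j) := by
      rw [closure_eq_self_union_frontier]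
      rintro (h | h)
      · exact Set.disjoint_left.1 (TriMesh.disjoint_boundary_domain hb) hxF (sub_subset_domain j h)
      · exact hxΓ (hΓ ▸ ⟨hxi, h⟩)
    refine mem_subElems_of_mem_closure hT (hull_mono hFT hxF)
      (isClosed_closure.isOpen_compl.mem_nhds hxj) ?_
    rintro y ⟨hyj, hyT⟩
    have hyd := subset_closure (TriMesh.interior_hull_subset_domain hT hyT)
    rw [hdom] at hyd
    exact hyd.resolve_right hyj

/-- The incidence number of an edge and a triangle. -/
def inc (𝒯 : CutMesh) (F T : Finset Plane) : ℝ :=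
  (if T ∈ 𝒯.minusElems F then 1 else 0) - (if T ∈ 𝒯.plusElems F then 1 else 0)

lemma jump_eq_sum_inc (q : Finset Plane → Plane → ℝ) (F : Finset Plane) (x : Plane) :
    𝒯.jump q F x = ∑ T ∈ 𝒯.elems, 𝒯.inc F T * q T x := by
  have h1 : ∀ 𝒜 ⊆ 𝒯.elems, ∑ T ∈ 𝒜, q T x
      = ∑ T ∈ 𝒯.elems, (if T ∈ 𝒜 then 1 else 0) * q T x := by
    intro 𝒜 h𝒜
    simp only [ite_mul, one_mul, zero_mul]
    rw [Finset.sum_ite_mem, Finset.inter_eq_right.2 h𝒜]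
  unfold jump inc
  rw [h1 (𝒯.minusElems F) (Finset.filter_subset _ _),
    h1 (𝒯.plusElems F) (Finset.filter_subset _ _), ← Finset.sum_sub_distrib]
  exact Finset.sum_congr rfl fun T _ => by ring

lemma inc_eq_zero {F T : Finset Plane} (h : ¬ F ⊆ T) : 𝒯.inc F T = 0 := by
  simp [inc, minusElems, plusElems, h]

/-- Membership in `{-1, 0, 1}`, in the form required by `exists_uniform_solution_bound`. -/
lemma sign_inc (F T : Finset Plane) : ((SignType.sign (𝒯.inc F T) : SignType) : ℝ) = 𝒯.inc F T := by
  unfold inc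
  split_ifs <;> simp

lemma abs_inc_le (F T : Finset Plane) : |𝒯.inc F T| ≤ 1 := by
  unfold inc
  split_ifs <;> simp

lemma edgeSign_mul_self (N : Plane) (F : Finset Plane) : 𝒯.edgeSign N F * 𝒯.edgeSign N F = 1 := by
  unfold edgeSign
  split_ifs <;> simp

lemma inner_eq_coord (u w : Plane) : ⟪u, w⟫ = u 0 * w 0 + u 1 * w 1 := by
  simp [PiLp.inner_apply, Fin.sum_univ_two]; ring

/-- The sign of an edge times its incidence number is the orientation of the triangle. -/
lemma edgeSign_mul_inc {N M P : Plane} (hT : {N, M, P} ∈ 𝒯.elems)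
    (hD : cross (M - N) (P - N) ≠ 0) :
    𝒯.edgeSign N {N, M} * 𝒯.inc {N, M} {N, M, P}
      = if 0 < cross (M - N) (P - N) then 1 else -1 := by
  have hNM : M ≠ N := by rintro rfl; simp at hD
  have hsub : ({N, M} : Finset Plane) ⊆ {N, M, P} := by intro x; simp; tauto
  have hE : {N, M} ∈ 𝒯.edges :=
    TriMesh.mem_edges.2 ⟨_, hT, hsub, Finset.card_pair hNM.symm⟩
  set n := 𝒯.normal {N, M} with hn
  have hperp : ⟪n, M - N⟫ = 0 := 𝒯.normal_perp _ hE N (by simp) M (by simp)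
  have hunit : ‖n‖ = 1 := 𝒯.normal_unit _ hE
  have hu : 0 < ‖M - N‖ ^ 2 := by
    have : 0 < ‖M - N‖ := norm_pos_iff.2 (sub_ne_zero.2 hNM)
    positivity
  have hn2 : n 0 * n 0 + n 1 * n 1 = 1 := by
    rw [← inner_eq_coord, real_inner_self_eq_norm_sq, hunit]; norm_num
  have hu2 : ‖M - N‖ ^ 2 = (M - N) 0 * (M - N) 0 + (M - N) 1 * (M - N) 1 := by
    rw [← inner_eq_coord, real_inner_self_eq_norm_sq]
  have hperp' := hperp
  rw [inner_eq_coord] at hperp'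
  -- The unit normal `n` is orthogonal to the edge. The sign of `cross n (M - N)` gives the edge
  -- sign, and its product with the orientation of the triangle decides on which side of the edge
  -- `P` lies.
  have hα2 : cross n (M - N) ^ 2 = ‖M - N‖ ^ 2 := by
    rw [hu2, cross]
    linear_combination ((M - N) 0 * (M - N) 0 + (M - N) 1 * (M - N) 1) * hn2
      - (n 0 * (M - N) 0 + n 1 * (M - N) 1) * hperp'
  have hα : cross n (M - N) ≠ 0 := by
    intro h; rw [h] at hα2; simp at hα2; rw [← hα2] at hu; simp at hu
  have hin : ⟪n, P - N⟫ * ‖M - N‖ ^ 2 = - (cross n (M - N) * cross (M - N) (P - N)) := by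
    rw [hu2, inner_eq_coord, cross, cross]
    linear_combination ((M - N) 0 * (P - N) 0 + (M - N) 1 * (P - N) 1) * hperp'
  have hPM : ⟪n, P - M⟫ = ⟪n, P - N⟫ := by
    rw [show P - M = (P - N) - (M - N) by abel, inner_sub_right, hperp, sub_zero]
  have hNM' : ⟪n, N - M⟫ = 0 := by
    rw [← neg_sub, inner_neg_right, hperp, neg_zero]
  have hminus : {N, M, P} ∈ 𝒯.minusElems {N, M} ↔ ⟪n, P - N⟫ ≤ 0 := by
    simp only [minusElems, Finset.mem_filter, hT, hsub, true_and, ← hn]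
    simp [hperp, hPM, hNM']
  have hplus : {N, M, P} ∈ 𝒯.plusElems {N, M} ↔ 0 ≤ ⟪n, P - N⟫ := by
    simp only [plusElems, Finset.mem_filter, hT, hsub, true_and, ← hn]
    simp [hperp, hPM, hNM']
  have hsign : 𝒯.edgeSign N {N, M} = if 0 < cross n (M - N) then 1 else -1 := by
    simp only [edgeSign, ← hn]
    congr 1
    simp [cross]
  have hinc : 𝒯.inc {N, M} {N, M, P} = if ⟪n, P - N⟫ < 0 then 1 else -1 := by
    have h0 : ⟪n, P - N⟫ ≠ 0 := by
      intro h; rw [h, zero_mul] at hin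
      exact mul_ne_zero hα hD (by linarith)
    rw [inc]
    simp only [hminus, hplus]
    rcases lt_or_gt_of_ne h0 with h | h
    · rw [if_pos h.le, if_neg (not_le.2 h), if_pos h, sub_zero]
    · rw [if_neg (not_le.2 h), if_pos h.le, if_neg (not_lt.2 h.le), zero_sub]
  rw [hsign, hinc]
  have hiff : ⟪n, P - N⟫ < 0 ↔ 0 < cross n (M - N) * cross (M - N) (P - N) := by
    constructor
    · intro h; nlinarith
    · intro h; by_contra! h'; nlinarith
  simp only [hiff]
  rcases lt_or_gt_of_ne hα with h | h <;> rcases lt_or_gt_of_ne hD with h' | h'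
  · rw [if_neg (not_lt.2 h.le), if_pos (mul_pos_of_neg_of_neg h h'), if_neg (not_lt.2 h'.le)]
    norm_num
  · rw [if_neg (not_lt.2 h.le), if_neg (not_lt.2 (mul_neg_of_neg_of_pos h h').le), if_pos h']
    norm_num
  · rw [if_pos h, if_neg (not_lt.2 (mul_neg_of_pos_of_neg h h').le), if_neg (not_lt.2 h'.le)]
    norm_num
  · rw [if_pos h, if_pos (mul_pos h h'), if_pos h']
    norm_num

/-- A node all of whose edges belong to a closed part of `ℱ_h^i` carries a constraint. -/
lemma mem_constrainedNodes {c : BoundaryEdges} (hc : c = .included → 𝒯.SimpleBoundary) {i : Fin 2}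
    {N : Plane} {K : Finset (Finset Plane)} (hK : 𝒯.IsLinkClosed N K) (hne : K.Nonempty)
    (hsub : K ⊆ 𝒯.subEdges c i) :
    N ∈ 𝒯.constrainedNodes c i ∧ ∀ F ∈ 𝒯.edges, N ∈ F → F ∈ K := by
  obtain ⟨F₀, hF₀⟩ := id hne
  obtain ⟨T₀, hT₀, hFT₀, -⟩ := TriMesh.mem_edges.1 (hK.mem_edges F₀ hF₀)
  have hnode : N ∈ 𝒯.nodes := Finset.mem_biUnion.2 ⟨T₀, hT₀, hFT₀ (hK.mem F₀ hF₀)⟩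
  cases c with
  | omitted =>
    -- Here all edges meet the open subdomain, so pinch points of the boundary play no role.
    have hb : ∀ F ∈ K, ¬ 𝒯.IsBoundaryEdge F := by
      intro F hF
      have := (Finset.mem_filter.1 (hsub hF)).2
      simp only [reduceCtorEq, false_and, or_false] at this
      exact not_boundary_of_meets this
    refine ⟨Finset.mem_filter.2 ⟨hnode, ?_⟩, fun F hF hN => hK.mem_of_no_boundary hne hb hF hN⟩
    change N ∈ interior (𝒯.extDomain i)
    rw [mem_interior_iff_mem_nhds]
    refine Filter.mem_of_superset (hK.iUnion_hull_mem_nhds hne hb) ?_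
    refine Set.iUnion₂_subset fun T hT => ?_
    obtain ⟨hT, F, hF, hFT⟩ := Finset.mem_filter.1 hT
    exact Set.subset_biUnion_of_mem (u := fun T => hull T)
      (mem_subElems_of_subset (hsub hF) hT hFT)
  | included =>
    have hall : ∀ F ∈ 𝒯.edges, N ∈ F → F ∈ K :=
      fun F hF hN => hK.mem_of_simpleBoundary hne (hc rfl) hF hN
    refine ⟨Finset.mem_filter.2 ⟨hnode, ?_⟩, hall⟩
    change 𝒯.extDomain i ∈ 𝓝[closure 𝒯.domain] N
    rw [mem_nhdsWithin_iff_exists_mem_nhds_inter]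
    -- Close to `N` only triangles with vertex `N` occur; their edges at `N` are all in `K`.
    refine ⟨(⋃ T ∈ 𝒯.elems.filter fun T => N ∉ T, hull T)ᶜ,
      (TriMesh.isClosed_iUnion_hull _).isOpen_compl.mem_nhds ?_, ?_⟩
    · intro h
      obtain ⟨T, hT, hNT⟩ := Set.mem_iUnion₂.1 h
      rw [Finset.mem_filter] at hT
      exact hT.2 (TriMesh.mem_of_mem_hull hT₀ hT.1 (hFT₀ (hK.mem F₀ hF₀)) hNT)
    · rintro y ⟨hy, hyd⟩
      rw [TriMesh.closure_domain] at hyd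
      obtain ⟨T, hT, hyT⟩ := Set.mem_iUnion₂.1 hyd
      have hNT : N ∈ T := by
        by_contra h
        exact hy (Set.mem_iUnion₂.2 ⟨T, Finset.mem_filter.2 ⟨hT, h⟩, hyT⟩)
      obtain ⟨F, hFT, hFc, hNF⟩ := TriMesh.exists_edge hT hNT
      have hF := hall F (TriMesh.mem_edges.2 ⟨T, hT, hFT, hFc⟩) hNF
      exact Set.mem_iUnion₂.2 ⟨T, mem_subElems_of_subset (hsub hF) hT hFT, hyT⟩

/-- The only obstruction to prescribing the jumps at a node is the constraint. -/
lemma sum_mul_eq_zero_of_kernel {c : BoundaryEdges} (hc : c = .included → 𝒯.SimpleBoundary)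
    {i : Fin 2} {N : Plane} {g l : Finset Plane → ℝ}
    (hg : N ∈ 𝒯.constrainedNodes c i →
      ∑ F ∈ (𝒯.subEdges c i).filter (fun F => N ∈ F), 𝒯.edgeSign N F * g F = 0)
    (hl : ∀ T ∈ 𝒯.subElems i, N ∈ T →
      ∑ F ∈ (𝒯.subEdges c i).filter (fun F => N ∈ F), l F * 𝒯.inc F T = 0) :
    ∑ F ∈ (𝒯.subEdges c i).filter (fun F => N ∈ F), l F * g F = 0 := by
  set R := (𝒯.subEdges c i).filter (fun F => N ∈ F) with hR
  by_cases h0 : ∀ F ∈ R, l F = 0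
  · exact Finset.sum_eq_zero fun F hF => by rw [h0 F hF, zero_mul]
  push Not at h0
  obtain ⟨F₀, hF₀, hl₀⟩ := h0
  obtain ⟨κ, hlκ⟩ : ∃ κ : Finset Plane → ℝ, ∀ F, l F = κ F * 𝒯.edgeSign N F :=
    ⟨fun F => l F * 𝒯.edgeSign N F, fun F => by rw [mul_assoc, edgeSign_mul_self, mul_one]⟩
  have hκ₀ : κ F₀ ≠ 0 := by
    intro h; rw [hlκ, h, zero_mul] at hl₀; exact hl₀ rfl
  -- After removal of the signs, the kernel equation of a triangle compares the values of `κ` on its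
  -- two edges at `N`; this makes the level set closed.
  set K := R.filter fun F => κ F = κ F₀ with hK
  have hRe : ∀ F ∈ R, F ∈ 𝒯.edges := fun F hF =>
    (Finset.mem_filter.1 (Finset.mem_filter.1 hF).1).1
  have hKc : 𝒯.IsLinkClosed N K := by
    refine ⟨fun F hF => hRe F (Finset.mem_filter.1 hF).1,
      fun F hF => (Finset.mem_filter.1 (Finset.mem_filter.1 hF).1).2, ?_⟩
    intro T hT F hF hFT F' hF'T hF'c hNF'
    obtain ⟨hFR, hFκ⟩ := Finset.mem_filter.1 hF
    obtain ⟨hFs, hNF⟩ := Finset.mem_filter.1 hFR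
    obtain ⟨M, P, hMN, rfl, rfl, hP, hD⟩ := TriMesh.exists_vertices hT hFT
      (TriMesh.card_edge (hRe F hFR)) hNF
    simp only [Finset.mem_insert, Finset.mem_singleton, not_or] at hP
    rcases TriMesh.edges_at_vertex hD hF'T hF'c hNF' with rfl | rfl
    · exact hF
    have hne : ({N, M} : Finset Plane) ≠ {N, P} := by
      intro h
      have : P ∈ ({N, M} : Finset Plane) := by rw [h]; simp
      simp only [Finset.mem_insert, Finset.mem_singleton] at this
      tauto
    have hsum := hl _ (mem_subElems_of_subset hFs hT hFT) (by simp)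
    have hsum' : ∑ F ∈ R, l F * 𝒯.inc F {N, M, P}
        = ∑ F ∈ R ∩ {{N, M}, {N, P}}, l F * 𝒯.inc F {N, M, P} := by
      symm
      refine Finset.sum_subset Finset.inter_subset_left fun G hG hG' => ?_
      by_cases hGT : G ⊆ {N, M, P}
      · refine absurd (Finset.mem_inter.2 ⟨hG, ?_⟩) hG'
        have := TriMesh.edges_at_vertex hD hGT (TriMesh.card_edge (hRe G hG))
          (Finset.mem_filter.1 hG).2
        simpa using this
      · rw [inc_eq_zero hGT, mul_zero]
    rw [hsum'] at hsum
    have e1 := edgeSign_mul_inc hT hD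
    have hswap : ({N, P, M} : Finset Plane) = {N, M, P} := by
      rw [Finset.pair_comm P M]
    have hD' : cross (P - N) (M - N) ≠ 0 := by rw [cross_swap]; exact neg_ne_zero.2 hD
    have hT' : {N, P, M} ∈ 𝒯.elems := by rw [hswap]; exact hT
    have e2 := edgeSign_mul_inc hT' hD'
    rw [hswap] at e2
    have e3 : (if 0 < cross (P - N) (M - N) then (1 : ℝ) else -1)
        = - (if 0 < cross (M - N) (P - N) then (1 : ℝ) else -1) := by
      rw [cross_swap (M - N)]
      rcases lt_or_gt_of_ne hD with h | h
      · rw [if_pos (by linarith), if_neg (by linarith)]; norm_num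
      · rw [if_neg (by linarith), if_pos h]
    have e4 : (if 0 < cross (M - N) (P - N) then (1 : ℝ) else -1) ≠ 0 := by
      split_ifs <;> norm_num
    rw [e3] at e2
    by_cases hPR : {N, P} ∈ R
    · have hRR : R ∩ {{N, M}, {N, P}} = {{N, M}, {N, P}} := by
        rw [Finset.inter_eq_right]
        intro G hG
        simp only [Finset.mem_insert, Finset.mem_singleton] at hG
        rcases hG with rfl | rfl <;> assumption
      rw [hRR, Finset.sum_pair hne, hlκ {N, M}, hlκ {N, P}] at hsum
      refine Finset.mem_filter.2 ⟨hPR, ?_⟩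
      have h5 : (κ {N, M} - κ {N, P}) * (if 0 < cross (M - N) (P - N) then (1 : ℝ) else -1) = 0 := by
        linear_combination hsum - κ {N, M} * e1 - κ {N, P} * e2
      have h6 := (mul_eq_zero.1 h5).resolve_right e4
      rw [← hFκ]; linarith
    -- With the other edge missing, the equation has a single term and would force `κ F₀ = 0`.
    · have hRR : R ∩ {{N, M}, {N, P}} = {{N, M}} := by
        ext G
        simp only [Finset.mem_inter, Finset.mem_insert, Finset.mem_singleton]
        constructor
        · rintro ⟨h, rfl | rfl⟩
          · rfl
          · exact absurd h hPR
        · rintro rfl; exact ⟨hFR, Or.inl rfl⟩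
      rw [hRR, Finset.sum_singleton, hlκ {N, M}, mul_assoc, e1, hFκ] at hsum
      exact absurd hsum (mul_ne_zero hκ₀ e4)
  have hKne : K.Nonempty := ⟨F₀, Finset.mem_filter.2 ⟨hF₀, rfl⟩⟩
  obtain ⟨hcon, hall⟩ := mem_constrainedNodes (c := c) (i := i) hc hKc hKne (fun F hF =>
    (Finset.mem_filter.1 (Finset.mem_filter.1 hF).1).1)
  have : ∑ F ∈ R, l F * g F = κ F₀ * ∑ F ∈ R, 𝒯.edgeSign N F * g F := by
    rw [Finset.mul_sum]
    refine Finset.sum_congr rfl fun F hF => ?_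
    have hFK := (Finset.mem_filter.1 (hall F (hRe F hF) (Finset.mem_filter.1 hF).2)).2
    rw [hlκ, hFK, mul_assoc]
  rw [this, hg hcon, mul_zero]

/-- Nodal values of the triangles at a node with prescribed jumps, with a uniform bound. -/
lemma exists_nodal_values (n : ℕ) : ∃ C : ℝ, 0 < C ∧ ∀ (𝒯 : CutMesh) (c : BoundaryEdges),
    (c = .included → 𝒯.SimpleBoundary) → ∀ (i : Fin 2) (N : Plane),
    (𝒯.elems.filter fun T => N ∈ T).card ≤ n → (𝒯.edges.filter fun F => N ∈ F).card ≤ n →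
    ∀ g : Finset Plane → ℝ,
    (N ∈ 𝒯.constrainedNodes c i →
      ∑ F ∈ (𝒯.subEdges c i).filter (fun F => N ∈ F), 𝒯.edgeSign N F * g F = 0) →
    ∃ x : Finset Plane → ℝ,
      (∀ F ∈ 𝒯.subEdges c i, N ∈ F → ∑ T ∈ 𝒯.subElems i, 𝒯.inc F T * x T = g F) ∧
      ∀ T, x T ^ 2 ≤ C * ∑ F ∈ (𝒯.subEdges c i).filter (fun F => N ∈ F), g F ^ 2 := by
  obtain ⟨C, hC0, hC⟩ := exists_uniform_solution_bound n
  refine ⟨C, hC0, fun 𝒯 c hc i N hn hn' g hg => ?_⟩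
  set R := (𝒯.subEdges c i).filter (fun F => N ∈ F) with hR
  set S := (𝒯.subElems i).filter (fun T => N ∈ T) with hS
  obtain ⟨x, hx1, hx2⟩ := hC R S
    (by
      rw [Fintype.card_coe]
      exact (Finset.card_le_card (Finset.filter_subset_filter _ (Finset.filter_subset _ _))).trans hn')
    (by
      rw [Fintype.card_coe]
      exact (Finset.card_le_card (Finset.filter_subset_filter _ (Finset.filter_subset _ _))).trans hn)
    (fun F T => 𝒯.inc F T) (fun F T => sign_inc _ _) (fun F => g F) (by
      intro l hl
      have h := sum_mul_eq_zero_of_kernel (l := fun F => if hF : F ∈ R then l ⟨F, hF⟩ else 0) hc hg (by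
        intro T hT hNT
        rw [← hl ⟨T, Finset.mem_filter.2 ⟨hT, hNT⟩⟩, ← hR, ← Finset.sum_coe_sort]
        exact Finset.sum_congr rfl fun F _ => by simp)
      rw [← hR, ← Finset.sum_coe_sort] at h
      rw [← h]
      exact Finset.sum_congr rfl fun F _ => by simp)
  refine ⟨fun T => if hT : T ∈ S then x ⟨T, hT⟩ else 0, fun F hF hNF => ?_, fun T => ?_⟩
  · rw [← hx1 ⟨F, Finset.mem_filter.2 ⟨hF, hNF⟩⟩]
    rw [← Finset.sum_subset (Finset.filter_subset (fun T => N ∈ T) (𝒯.subElems i)), ← hS,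
      ← Finset.sum_coe_sort]
    · exact Finset.sum_congr rfl fun T _ => by simp
    · intro T _ hT
      rw [← hS] at hT
      dsimp only
      rw [dif_neg hT, mul_zero]
  · rw [← Finset.sum_coe_sort]
    dsimp only
    split_ifs with hT
    · exact hx2 _
    · rw [zero_pow two_ne_zero]; positivity

end CutMesh
-- Affine functions on triangles and counting by shape regularity.
open MeasureTheory

/-- The preimage of the interval `[-√Q, √Q]` under an affine map is convex. -/
lemma sq_le_of_mem_hull {f : Plane →ᵃ[ℝ] ℝ} {S : Finset Plane} {Q : ℝ} (hQ : 0 ≤ Q)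
    (h : ∀ N ∈ S, f N ^ 2 ≤ Q) {x : Plane} (hx : x ∈ hull S) : f x ^ 2 ≤ Q := by
  have hc : Convex ℝ (f ⁻¹' Set.Icc (-√Q) (√Q)) := (convex_Icc _ _).affine_preimage f
  have hsub : (S : Set Plane) ⊆ f ⁻¹' Set.Icc (-√Q) (√Q) := fun N hN =>
    abs_le.1 (Real.abs_le_sqrt (h N hN))
  exact (Real.sq_le hQ).2 (convexHull_min hsub hc hx)

lemma eq_of_mem_hull {f g : Plane →ᵃ[ℝ] ℝ} {S : Finset Plane} (h : ∀ N ∈ S, f N = g N)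
    {x : Plane} (hx : x ∈ hull S) : f x = g x := by
  have := sq_le_of_mem_hull (f := f - g) le_rfl (fun N hN => by simp [h N hN]) hx
  have h0 : f x - g x = 0 := by
    refine pow_eq_zero_iff two_ne_zero |>.1 (le_antisymm ?_ (sq_nonneg _))
    simpa using this
  linarith

lemma exists_affineMap_sum {ι : Type*} (s : Finset ι) (a : ι → ℝ) (f : ι → Plane →ᵃ[ℝ] ℝ) :
    ∃ g : Plane →ᵃ[ℝ] ℝ, ∀ x, g x = ∑ j ∈ s, a j * f j x := by
  induction s using Finset.induction_on with
  | empty => exact ⟨0, by simp⟩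
  | insert j s hj ih =>
    obtain ⟨g, hg⟩ := ih
    exact ⟨a j • f j + g, fun x => by rw [Finset.sum_insert hj, ← hg]; simp⟩

lemma inner_gradient_affineMap (f : Plane →ᵃ[ℝ] ℝ) (x u : Plane) :
    ⟪gradient f x, u⟫ = f.linear u := by
  have h : HasFDerivAt f (LinearMap.toContinuousLinearMap f.linear) x := by
    have h1 := ((LinearMap.toContinuousLinearMap f.linear).hasFDerivAt (x := x)).add_const (f 0)
    refine h1.congr_of_eventuallyEq (Filter.Eventually.of_forall fun y => ?_)
    exact congrFun f.decomp y
  rw [gradient, InnerProductSpace.toDual_symm_apply, h.fderiv]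
  rfl

/-- The inverse inequality: at the points at distance `r` from the centre along `± G`, the squares
of `f` add up to `2 f(c)² + 2 r² |G|²`. -/
lemma sq_mul_gradient_sq_le {f : Plane →ᵃ[ℝ] ℝ} {A : Set Plane} {Q r : ℝ} {c : Plane}
    (hr : 0 ≤ r) (hA : Metric.closedBall c r ⊆ A) (h : ∀ x ∈ A, f x ^ 2 ≤ Q) (x : Plane) :
    r ^ 2 * ‖gradient f x‖ ^ 2 ≤ Q := by
  set G := gradient f x with hG
  by_cases hG0 : G = 0
  · rw [hG0]
    simpa using (sq_nonneg _).trans (h c (hA (Metric.mem_closedBall_self hr)))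
  have hn : ‖G‖ ≠ 0 := norm_ne_zero_iff.2 hG0
  set u : Plane := (r / ‖G‖) • G with hu
  have hun : ‖u‖ = r := by
    rw [hu, norm_smul, Real.norm_of_nonneg (by positivity)]; field_simp
  have h1 : f.linear u = r * ‖G‖ := by
    rw [← inner_gradient_affineMap f x, ← hG, hu, inner_smul_right, real_inner_self_eq_norm_sq]
    field_simp
  have h2 : f (c + u) = f c + r * ‖G‖ := by
    rw [add_comm c u, ← vadd_eq_add, f.map_vadd, h1, vadd_eq_add, add_comm]
  have h3 : f (c - u) = f c - r * ‖G‖ := by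
    rw [sub_eq_add_neg, add_comm c, ← vadd_eq_add, f.map_vadd, map_neg, h1, vadd_eq_add]; ring
  have h4 := h (c + u) (hA (by simp [hun]))
  have h5 := h (c - u) (hA (by simp [hun]))
  rw [h2] at h4
  rw [h3] at h5
  nlinarith [sq_nonneg (f c)]

lemma setIntegral_le_mul {ν : Measure Plane} {s : Set Plane} {f : Plane → ℝ} {C L : ℝ}
    (hC : 0 ≤ C) (hL : 0 ≤ L) (hs : ν s ≤ ENNReal.ofReal L) (hf : ∀ x ∈ s, |f x| ≤ C) :
    ∫ x in s, f x ∂ν ≤ C * L := by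
  have h1 := norm_setIntegral_le_of_norm_le_const (f := f) (C := C)
    (hs.trans_lt ENNReal.ofReal_lt_top) hf
  refine (le_abs_self _).trans (h1.trans ?_)
  exact mul_le_mul_of_nonneg_left (ENNReal.toReal_le_of_le_ofReal hL hs) hC

lemma hausdorffMeasure_hull_edge {F : Finset Plane} (hF : F.card = 2) :
    μH[1] (hull F) ≤ ENNReal.ofReal (size F) := by
  obtain ⟨a, b, -, rfl⟩ := Finset.card_eq_two.1 hF
  rw [hull_pair, size_pair, hausdorffMeasure_segment, edist_dist]

lemma volume_closedBall_plane (x : Plane) {s : ℝ} (hs : 0 ≤ s) :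
    volume (Metric.closedBall x s) = ENNReal.ofReal (s ^ 2 * Real.pi) := by
  rw [EuclideanSpace.volume_closedBall_fin_two, ← ENNReal.ofReal_pow hs,
    ENNReal.ofReal_mul (by positivity)]

lemma volume_hull_le {T : Finset Plane} {N : Plane} (hN : N ∈ hull T) :
    volume (hull T) ≤ ENNReal.ofReal (size T ^ 2 * Real.pi) := by
  have h : hull T ⊆ Metric.closedBall N (size T) := fun x hx => dist_le_size hx hN
  exact (measure_mono h).trans_eq (volume_closedBall_plane N (size_nonneg T))

namespace TriMesh

variable {𝒯 : TriMesh}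

lemma exists_affine_interpolation {T : Finset Plane} (hT : T ∈ 𝒯.elems) (y : Plane → ℝ) :
    ∃ f : Plane →ᵃ[ℝ] ℝ, ∀ N ∈ T, f N = y N := by
  have htop := (𝒯.indep T hT).affineSpan_eq_top_iff_card_eq_finrank_add_one.2
    (by simp [𝒯.card_eq T hT])
  let B : AffineBasis T ℝ Plane := ⟨((↑) : T → Plane), 𝒯.indep T hT, htop⟩
  refine ⟨(∑ j : T, y j • (LinearMap.proj j : (T → ℝ) →ₗ[ℝ] ℝ)).toAffineMap.comp B.coords, ?_⟩
  intro N hN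
  have hB : B ⟨N, hN⟩ = N := rfl
  have : ∀ j : T, B.coord j N = if j = ⟨N, hN⟩ then 1 else 0 := by
    intro j
    conv_lhs => rw [← hB]
    rw [B.coord_apply]
  simp [this]

lemma size_pos {T : Finset Plane} (hT : T ∈ 𝒯.elems) : 0 < size T := by
  obtain ⟨a, ha, b, hb, hab⟩ := Finset.one_lt_card.1 (by rw [𝒯.card_eq T hT]; norm_num)
  exact (dist_pos.2 hab).trans_le (dist_le_size (mem_hull_of_mem ha) (mem_hull_of_mem hb))

/-- A shape regular mesh has boundedly many triangles at each node. -/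
lemma card_elems_le {σ : ℝ} (h : 𝒯.ShapeRegular σ) (N : Plane) :
    ((𝒯.elems.filter fun T => N ∈ T).card : ℝ) ≤ 4 * σ ^ 2 := by
  set 𝒜 := 𝒯.elems.filter fun T => N ∈ T with h𝒜
  rcases 𝒜.eq_empty_or_nonempty with he | hne
  · rw [he]; simp; positivity
  have hmem : ∀ T ∈ 𝒜, T ∈ 𝒯.elems ∧ N ∈ T := fun T hT => Finset.mem_filter.1 hT
  -- All triangles at `N` are shrunk towards `N` to the size `ε` of the smallest one. Their
  -- inscribed discs then have radius at least `ε / (2σ)`, overlap only in null sets and lie in the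
  -- disc of radius `ε` about `N`; comparing areas bounds their number.
  obtain ⟨T₀, hT₀, hmin⟩ := Finset.exists_min_image 𝒜 size hne
  set ε := size T₀ with hε
  have hε0 : 0 < ε := size_pos (hmem T₀ hT₀).1
  choose! c r hr hball hσ using h
  set q : Finset Plane → ℝ := fun T => ε / size T * r T with hq
  set B : Finset Plane → Set Plane :=
    fun T => Metric.closedBall (N + (ε / size T) • (c T - N)) (q T) with hB
  have hB1 : ∀ T ∈ 𝒜, B T ⊆ hull T ∩ Metric.closedBall N ε := by
    intro T hT x hx
    obtain ⟨hTe, hNT⟩ := hmem T hT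
    have hsz := size_pos hTe
    have ht0 : 0 < ε / size T := by positivity
    have ht1 : ε / size T ≤ 1 := (div_le_one hsz).2 (hmin T hT)
    set t := ε / size T with ht
    set z : Plane := N + t⁻¹ • (x - N) with hz
    have hxz : x = N + t • (z - N) := by
      rw [hz, add_sub_cancel_left, smul_smul, mul_inv_cancel₀ ht0.ne', one_smul, add_sub_cancel]
    have hzT : z ∈ hull T := by
      refine hball T hTe ?_
      rw [hB, Metric.mem_closedBall, dist_eq_norm, hxz] at hx
      have e : N + t • (z - N) - (N + t • (c T - N)) = t • (z - c T) := by module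
      rw [e, norm_smul, Real.norm_of_nonneg ht0.le] at hx
      rw [Metric.mem_closedBall, dist_eq_norm]
      exact le_of_mul_le_mul_left hx ht0
    constructor
    · have := (convex_hull T) (mem_hull_of_mem hNT) hzT (a := 1 - t) (b := t) (by linarith) ht0.le
        (by ring)
      rwa [show (1 - t) • N + t • z = x by rw [hxz]; module] at this
    · rw [Metric.mem_closedBall, dist_eq_norm, hxz, add_sub_cancel_left, norm_smul,
        Real.norm_of_nonneg ht0.le, ← dist_eq_norm]
      calc t * dist z N ≤ t * size T := by
            gcongr; exact dist_le_size hzT (mem_hull_of_mem hNT)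
        _ = ε := by rw [ht]; field_simp
  have hq0 : ∀ T ∈ 𝒜, 0 ≤ q T := by
    intro T hT
    have := hr T (hmem T hT).1
    have := size_pos (hmem T hT).1
    positivity
  have hsum : ∑ T ∈ 𝒜, volume (B T) ≤ volume (Metric.closedBall N ε) := by
    rw [← measure_biUnion_finset₀]
    · exact measure_mono (Set.iUnion₂_subset fun T hT => (hB1 T hT).trans Set.inter_subset_right)
    · intro T hT T' hT' hne
      refine measure_mono_null ?_ (volume_hull_inter (hmem T hT).1 (hmem T' hT').1 hne)
      exact Set.inter_subset_inter ((hB1 T hT).trans Set.inter_subset_left)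
        ((hB1 T' hT').trans Set.inter_subset_left)
    · exact fun T _ => Metric.isClosed_closedBall.measurableSet.nullMeasurableSet
  rw [volume_closedBall_plane N hε0.le,
    Finset.sum_congr rfl fun T hT => volume_closedBall_plane _ (hq0 T hT),
    ← ENNReal.ofReal_sum_of_nonneg fun T _ => by positivity,
    ENNReal.ofReal_le_ofReal_iff (by positivity), ← Finset.sum_mul] at hsum
  have hsum' := le_of_mul_le_mul_right hsum Real.pi_pos
  have hle : ∀ T ∈ 𝒜, ε ^ 2 ≤ 4 * σ ^ 2 * q T ^ 2 := by
    intro T hT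
    have hTe := (hmem T hT).1
    have hsz := size_pos hTe
    have h1 : size T ^ 2 ≤ (σ * (2 * r T)) ^ 2 :=
      pow_le_pow_left₀ hsz.le (hσ T hTe) 2
    have : 4 * σ ^ 2 * q T ^ 2 = (ε / size T) ^ 2 * (σ * (2 * r T)) ^ 2 := by rw [hq]; ring
    rw [this]
    calc ε ^ 2 = (ε / size T) ^ 2 * size T ^ 2 := by field_simp
      _ ≤ _ := by gcongr
  have h2 : (𝒜.card : ℝ) * ε ^ 2 ≤ 4 * σ ^ 2 * ε ^ 2 := by
    calc (𝒜.card : ℝ) * ε ^ 2 = ∑ T ∈ 𝒜, ε ^ 2 := by simp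
      _ ≤ ∑ T ∈ 𝒜, 4 * σ ^ 2 * q T ^ 2 := Finset.sum_le_sum hle
      _ = 4 * σ ^ 2 * ∑ T ∈ 𝒜, q T ^ 2 := by rw [Finset.mul_sum]
      _ ≤ 4 * σ ^ 2 * ε ^ 2 := by gcongr
  exact le_of_mul_le_mul_right h2 (by positivity)

lemma card_edges_le {σ : ℝ} (h : 𝒯.ShapeRegular σ) (N : Plane) :
    ((𝒯.edges.filter fun F => N ∈ F).card : ℝ) ≤ 3 * (4 * σ ^ 2) := by
  have h1 : (𝒯.edges.filter fun F => N ∈ F).card ≤ (𝒯.elems.filter fun T => N ∈ T).card * 3 := by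
    refine (Finset.card_le_card (t := (𝒯.elems.filter fun T => N ∈ T).biUnion
      fun T => T.powersetCard 2) ?_).trans (Finset.card_biUnion_le_card_mul _ _ _ ?_)
    · intro F hF
      obtain ⟨hF, hN⟩ := Finset.mem_filter.1 hF
      obtain ⟨T, hT, hFT, hc⟩ := mem_edges.1 hF
      exact Finset.mem_biUnion.2 ⟨T, Finset.mem_filter.2 ⟨hT, hFT hN⟩,
        Finset.mem_powersetCard.2 ⟨hFT, hc⟩⟩
    · intro T hT
      rw [Finset.card_powersetCard, 𝒯.card_eq T (Finset.mem_filter.1 hT).1]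
      rfl
  have h2 := card_elems_le h N
  have h3 : ((𝒯.edges.filter fun F => N ∈ F).card : ℝ)
      ≤ (𝒯.elems.filter fun T => N ∈ T).card * 3 := by exact_mod_cast h1
  linarith

/-- The triangles which share a vertex with `T`. -/
def neighbors (𝒯 : TriMesh) (T : Finset Plane) : Finset (Finset Plane) :=
  𝒯.elems.filter fun T' => (T ∩ T').Nonempty

lemma card_neighbors_le {σ : ℝ} (h : 𝒯.ShapeRegular σ) {T : Finset Plane} (hT : T ∈ 𝒯.elems) :
    ((𝒯.neighbors T).card : ℝ) ≤ 3 * (4 * σ ^ 2) := by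
  have h1 : (𝒯.neighbors T).card ≤ ∑ N ∈ T, (𝒯.elems.filter fun T' => N ∈ T').card := by
    refine (Finset.card_le_card (t := T.biUnion fun N => 𝒯.elems.filter fun T' => N ∈ T') ?_).trans
      Finset.card_biUnion_le
    intro T' hT'
    obtain ⟨hT', N, hN⟩ := Finset.mem_filter.1 hT'
    rw [Finset.mem_inter] at hN
    exact Finset.mem_biUnion.2 ⟨N, hN.1, Finset.mem_filter.2 ⟨hT', hN.2⟩⟩
  calc ((𝒯.neighbors T).card : ℝ)
      ≤ ∑ N ∈ T, ((𝒯.elems.filter fun T' => N ∈ T').card : ℝ) := by exact_mod_cast h1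
    _ ≤ ∑ N ∈ T, 4 * σ ^ 2 := Finset.sum_le_sum fun N _ => card_elems_le h N
    _ = 3 * (4 * σ ^ 2) := by rw [Finset.sum_const, 𝒯.card_eq T hT]; simp

/-- Being neighbours is symmetric, so after exchanging the sums each `Q T` is counted once per
neighbour of `T`. -/
lemma sum_neighbors_le {σ : ℝ} (h : 𝒯.ShapeRegular σ) {Q : Finset Plane → ℝ} (hQ : ∀ T, 0 ≤ Q T) :
    ∑ T ∈ 𝒯.elems, ∑ T' ∈ 𝒯.neighbors T, Q T' ≤ 3 * (4 * σ ^ 2) * ∑ T ∈ 𝒯.elems, Q T := by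
  have : ∑ T ∈ 𝒯.elems, ∑ T' ∈ 𝒯.neighbors T, Q T'
      = ∑ T' ∈ 𝒯.elems, ∑ T ∈ 𝒯.neighbors T', Q T' := by
    refine Finset.sum_comm' fun T T' => ?_
    simp only [neighbors, Finset.mem_filter, Finset.inter_comm T T']
    tauto
  rw [this, Finset.mul_sum]
  refine Finset.sum_le_sum fun T hT => ?_
  rw [Finset.sum_const, nsmul_eq_mul]
  exact mul_le_mul_of_nonneg_right (card_neighbors_le h hT) (hQ T)

end TriMesh
-- Bounding the terms of the norm by the values of the function.
lemma size_sq_mul_gradient_sq_le {𝒯 : TriMesh} {σ : ℝ} (h : 𝒯.ShapeRegular σ) {T : Finset Plane}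
    (hT : T ∈ 𝒯.elems) {f : Plane →ᵃ[ℝ] ℝ} {Q : ℝ} (hf : ∀ x ∈ hull T, f x ^ 2 ≤ Q) (x : Plane) :
    size T ^ 2 * ‖gradient f x‖ ^ 2 ≤ 4 * σ ^ 2 * Q := by
  obtain ⟨c, r, hr, hball, hσ⟩ := h T hT
  have h1 : size T ^ 2 ≤ (σ * (2 * r)) ^ 2 := pow_le_pow_left₀ (size_nonneg T) hσ 2
  have h2 := sq_mul_gradient_sq_le hr.le hball hf x
  calc size T ^ 2 * ‖gradient f x‖ ^ 2 ≤ (σ * (2 * r)) ^ 2 * ‖gradient f x‖ ^ 2 := by gcongr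
    _ = 4 * σ ^ 2 * (r ^ 2 * ‖gradient f x‖ ^ 2) := by ring
    _ ≤ 4 * σ ^ 2 * Q := by gcongr

/-- This inequality makes the interface term robust in the contrast: each trace can be charged to
its own coefficient. -/
lemma kΓ_le {k : Fin 2 → ℝ} (hk : ∀ i, 0 < k i) (i : Fin 2) : CutMesh.kΓ k ≤ k i := by
  have h0 := hk 0
  have h1 := hk 1
  unfold CutMesh.kΓ
  rw [div_le_iff₀ (by positivity)]
  fin_cases i
  · simp only [Fin.zero_eta]; nlinarith [mul_pos h0 h0]
  · simp only [Fin.mk_one]; nlinarith [mul_pos h1 h1]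

lemma kΓ_nonneg {k : Fin 2 → ℝ} (hk : ∀ i, 0 < k i) : 0 ≤ CutMesh.kΓ k := by
  have h0 := hk 0
  have h1 := hk 1
  unfold CutMesh.kΓ
  positivity

namespace CutMesh

variable {𝒯 : CutMesh} {σ : ℝ}

/-- In the plane the factor `h_T⁻²` of the inverse inequality cancels against the area, at most `π
h_T²`. -/
lemma sum_gradient_le (h : 𝒯.ShapeRegular σ) {i : Fin 2} {v : Broken} {Q : Finset Plane → ℝ}
    (hQ : ∀ T, 0 ≤ Q T) (hv : ∀ T ∈ 𝒯.elems, ∀ x ∈ hull T, v i T x ^ 2 ≤ Q T) :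
    ∑ T ∈ 𝒯.subElems i, ∫ x in hull T ∩ 𝒯.sub i, ‖gradient (v i T) x‖ ^ 2
      ≤ 4 * σ ^ 2 * Real.pi * ∑ T ∈ 𝒯.elems, Q T := by
  rw [Finset.mul_sum]
  have hsub : 𝒯.subElems i ⊆ 𝒯.elems := Finset.filter_subset _ _
  refine (Finset.sum_le_sum fun T hT => ?_).trans
    (Finset.sum_le_sum_of_subset_of_nonneg hsub fun T _ _ => mul_nonneg (by positivity) (hQ T))
  have hTe := hsub hT
  have hsz := TriMesh.size_pos hTe
  obtain ⟨N, hN⟩ : T.Nonempty := Finset.card_pos.1 (by rw [𝒯.card_eq T hTe]; norm_num)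
  have hQT := hQ T
  have := setIntegral_le_mul (ν := volume) (s := hull T ∩ 𝒯.sub i)
    (f := fun x => ‖gradient (v i T) x‖ ^ 2) (C := 4 * σ ^ 2 * Q T / size T ^ 2)
    (L := size T ^ 2 * Real.pi) (by positivity) (by positivity)
    ((measure_mono Set.inter_subset_left).trans (volume_hull_le (mem_hull_of_mem hN))) (by
      intro x _
      rw [abs_of_nonneg (by positivity), le_div_iff₀ (by positivity), mul_comm]
      exact size_sq_mul_gradient_sq_le h hTe (hv T hTe) x)
  refine this.trans_eq ?_
  field_simp

lemma jumpDeriv_sq_le (h : 𝒯.ShapeRegular σ) {i : Fin 2} {v : Broken} {Q : Finset Plane → ℝ}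
    (hv : ∀ T ∈ 𝒯.elems, ∀ x ∈ hull T, v i T x ^ 2 ≤ Q T)
    {F : Finset Plane} (hF : F ∈ 𝒯.edges) (x : Plane) :
    size F ^ 2 * 𝒯.jumpDeriv v i F x ^ 2
      ≤ (4 * σ ^ 2) ^ 2 * ∑ T ∈ 𝒯.elems.filter (fun T => F ⊆ T), Q T := by
  have hcard : ((𝒯.elems.filter (fun T => F ⊆ T)).card : ℝ) ≤ 4 * σ ^ 2 := by
    obtain ⟨N, hN⟩ : F.Nonempty := Finset.card_pos.1 (by rw [TriMesh.card_edge hF]; norm_num)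
    have hsub : (𝒯.elems.filter fun T => F ⊆ T) ⊆ 𝒯.elems.filter fun T => N ∈ T := fun T hT =>
      Finset.mem_filter.2 ⟨(Finset.mem_filter.1 hT).1, (Finset.mem_filter.1 hT).2 hN⟩
    exact le_trans (by exact_mod_cast Finset.card_le_card hsub) (TriMesh.card_elems_le h N)
  have hj : 𝒯.jumpDeriv v i F x = ∑ T ∈ 𝒯.elems.filter (fun T => F ⊆ T),
      𝒯.inc F T * ⟪gradient (v i T) x, 𝒯.normal F⟫ := by
    rw [jumpDeriv, jump_eq_sum_inc, Finset.sum_filter_of_ne]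
    intro T _ hne
    by_contra hc
    rw [inc_eq_zero hc, zero_mul] at hne
    exact hne rfl
  rw [hj]
  calc size F ^ 2 * (∑ T ∈ 𝒯.elems.filter (fun T => F ⊆ T),
        𝒯.inc F T * ⟪gradient (v i T) x, 𝒯.normal F⟫) ^ 2
      ≤ size F ^ 2 * ((𝒯.elems.filter (fun T => F ⊆ T)).card *
        ∑ T ∈ 𝒯.elems.filter (fun T => F ⊆ T),
          (𝒯.inc F T * ⟪gradient (v i T) x, 𝒯.normal F⟫) ^ 2) := by
        gcongr; exact sq_sum_le_card_mul_sum_sq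
    _ ≤ size F ^ 2 * (4 * σ ^ 2 *
        ∑ T ∈ 𝒯.elems.filter (fun T => F ⊆ T), ‖gradient (v i T) x‖ ^ 2) := by
        refine mul_le_mul_of_nonneg_left (mul_le_mul hcard (Finset.sum_le_sum fun T hT => ?_)
          (Finset.sum_nonneg fun _ _ => sq_nonneg _) (by positivity)) (sq_nonneg _)
        rw [← sq_abs]
        refine pow_le_pow_left₀ (abs_nonneg _) ?_ 2
        rw [abs_mul]
        calc |𝒯.inc F T| * |⟪gradient (v i T) x, 𝒯.normal F⟫|
            ≤ 1 * (‖gradient (v i T) x‖ * ‖𝒯.normal F‖) :=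
              mul_le_mul (abs_inc_le F T) (abs_real_inner_le_norm _ _) (abs_nonneg _) zero_le_one
          _ = ‖gradient (v i T) x‖ := by rw [𝒯.normal_unit F hF]; ring
    _ = 4 * σ ^ 2 * ∑ T ∈ 𝒯.elems.filter (fun T => F ⊆ T),
        size F ^ 2 * ‖gradient (v i T) x‖ ^ 2 := by rw [← Finset.mul_sum]; ring
    _ ≤ 4 * σ ^ 2 * ∑ T ∈ 𝒯.elems.filter (fun T => F ⊆ T), 4 * σ ^ 2 * Q T := by
        refine mul_le_mul_of_nonneg_left (Finset.sum_le_sum fun T hT => ?_) (by positivity)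
        obtain ⟨hT, hFT⟩ := Finset.mem_filter.1 hT
        refine le_trans ?_ (size_sq_mul_gradient_sq_le h hT (hv T hT) x)
        gcongr
        · exact size_nonneg F
        · exact size_mono hFT
    _ = _ := by rw [← Finset.mul_sum]; ring

lemma ghost_le (h : 𝒯.ShapeRegular σ) {c : BoundaryEdges} {k : Fin 2 → ℝ} (hk : ∀ i, 0 < k i)
    {i : Fin 2} {v : Broken} {Q : Finset Plane → ℝ}
    (hQ : ∀ T, 0 ≤ Q T) (hv : ∀ T ∈ 𝒯.elems, ∀ x ∈ hull T, v i T x ^ 2 ≤ Q T) :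
    𝒯.ghost c k v i ≤ k i * (3 * (4 * σ ^ 2) ^ 2 * ∑ T ∈ 𝒯.elems, Q T) := by
  have hki := hk i
  have hsub : 𝒯.ghostEdges c i ⊆ 𝒯.edges :=
    (Finset.filter_subset _ _).trans (Finset.filter_subset _ _)
  have h1 : 𝒯.ghost c k v i ≤ ∑ F ∈ 𝒯.edges,
      k i * (4 * σ ^ 2) ^ 2 * ∑ T ∈ 𝒯.elems.filter (fun T => F ⊆ T), Q T := by
    unfold ghost
    refine (Finset.sum_le_sum fun F hF => ?_).trans
      (Finset.sum_le_sum_of_subset_of_nonneg hsub fun F _ _ =>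
        mul_nonneg (by positivity) (Finset.sum_nonneg fun T _ => hQ T))
    have hFe := hsub hF
    have hsz : 0 < size F := by
      obtain ⟨a, b, hab, rfl⟩ := Finset.card_eq_two.1 (TriMesh.card_edge hFe)
      rw [size_pair]; exact dist_pos.2 hab
    have hS : 0 ≤ ∑ T ∈ 𝒯.elems.filter (fun T => F ⊆ T), Q T := Finset.sum_nonneg fun T _ => hQ T
    set S := ∑ T ∈ 𝒯.elems.filter (fun T => F ⊆ T), Q T with hSdef
    have := setIntegral_le_mul (ν := μH[1]) (s := hull F)
      (f := fun x => k i * 𝒯.jumpDeriv v i F x ^ 2)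
      (C := k i * ((4 * σ ^ 2) ^ 2 * S / size F ^ 2)) (L := size F) (by positivity) hsz.le
      (hausdorffMeasure_hull_edge (TriMesh.card_edge hFe)) (by
        intro x _
        rw [abs_of_nonneg (by positivity)]
        gcongr
        rw [le_div_iff₀ (by positivity), mul_comm]
        exact jumpDeriv_sq_le h hv hFe x)
    calc _ ≤ size F * (k i * ((4 * σ ^ 2) ^ 2 * S / size F ^ 2) * size F) := by gcongr
      _ = _ := by field_simp
  refine h1.trans ?_
  rw [← Finset.mul_sum]
  have h2 : ∑ F ∈ 𝒯.edges, ∑ T ∈ 𝒯.elems.filter (fun T => F ⊆ T), Q T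
      = ∑ T ∈ 𝒯.elems, ∑ F ∈ 𝒯.edges.filter (fun F => F ⊆ T), Q T := by
    refine Finset.sum_comm' fun F T => ?_
    simp only [Finset.mem_filter]
    tauto
  -- The factor `3` is the number of edges of a triangle.
  have h3 : ∑ T ∈ 𝒯.elems, ∑ F ∈ 𝒯.edges.filter (fun F => F ⊆ T), Q T
      ≤ 3 * ∑ T ∈ 𝒯.elems, Q T := by
    rw [Finset.mul_sum]
    refine Finset.sum_le_sum fun T hT => ?_
    rw [Finset.sum_const, nsmul_eq_mul]
    refine mul_le_mul_of_nonneg_right ?_ (hQ T)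
    have : (𝒯.edges.filter (fun F => F ⊆ T)).card ≤ (T.powersetCard 2).card := by
      refine Finset.card_le_card fun F hF => ?_
      rw [Finset.mem_filter] at hF
      exact Finset.mem_powersetCard.2 ⟨hF.2, TriMesh.card_edge hF.1⟩
    rw [Finset.card_powersetCard, 𝒯.card_eq T hT] at this
    exact_mod_cast this
  rw [h2]
  calc _ ≤ k i * (4 * σ ^ 2) ^ 2 * (3 * ∑ T ∈ 𝒯.elems, Q T) := by gcongr
    _ = _ := by ring

/-- If the trace comes from other triangles, these contain `x ∈ hull T`, hence share a vertex with
`T` by conformity; Cauchy–Schwarz bounds their sum. -/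
lemma trace_sq_le (h : 𝒯.ShapeRegular σ) {i : Fin 2} {v : Broken} {Q : Finset Plane → ℝ}
    (hQ : ∀ T, 0 ≤ Q T) (hv : ∀ T ∈ 𝒯.elems, ∀ x ∈ hull T, v i T x ^ 2 ≤ Q T)
    {T : Finset Plane} (hT : T ∈ 𝒯.elems) {x : Plane} (hx : x ∈ hull T ∩ 𝒯.Γ) :
    𝒯.trace v i T x ^ 2 ≤ 3 * (4 * σ ^ 2) * ∑ T' ∈ 𝒯.neighbors T, Q T' := by
  have hcard := TriMesh.card_neighbors_le h hT
  have hS : 0 ≤ ∑ T' ∈ 𝒯.neighbors T, Q T' := Finset.sum_nonneg fun T _ => hQ T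
  refine le_trans ?_ (mul_le_mul_of_nonneg_right hcard hS)
  unfold trace
  split_ifs with hTi
  · have hTn : T ∈ 𝒯.neighbors T := Finset.mem_filter.2 ⟨hT, by
      rw [Finset.inter_self]
      exact Finset.card_pos.1 (by rw [𝒯.card_eq T hT]; norm_num)⟩
    have h1 : (1 : ℝ) ≤ (𝒯.neighbors T).card := by
      exact_mod_cast Finset.card_pos.2 ⟨T, hTn⟩
    calc v i T x ^ 2 ≤ Q T := hv T hT x hx.1
      _ ≤ ∑ T' ∈ 𝒯.neighbors T, Q T' := Finset.single_le_sum (fun T _ => hQ T) hTn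
      _ ≤ _ := le_mul_of_one_le_left hS h1
  · set 𝒜 := (𝒯.subElems i).filter (fun T' => hull T ∩ 𝒯.Γ ⊆ hull T') with h𝒜
    have hmem : ∀ T' ∈ 𝒜, T' ∈ 𝒯.elems ∧ x ∈ hull T' := by
      intro T' hT'
      rw [h𝒜, Finset.mem_filter] at hT'
      exact ⟨(Finset.mem_filter.1 hT'.1).1, hT'.2 hx⟩
    have hsub : 𝒜 ⊆ 𝒯.neighbors T := by
      intro T' hT'
      obtain ⟨hT'e, hxT'⟩ := hmem T' hT'
      refine Finset.mem_filter.2 ⟨hT'e, ?_⟩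
      have : x ∈ hull (T ∩ T') := by
        rw [← 𝒯.conforming T hT T' hT'e]; exact ⟨hx.1, hxT'⟩
      by_contra hne
      rw [Finset.not_nonempty_iff_eq_empty] at hne
      rw [hne] at this
      simp [hull] at this
    calc (∑ T' ∈ 𝒜, v i T' x) ^ 2 ≤ 𝒜.card * ∑ T' ∈ 𝒜, v i T' x ^ 2 := sq_sum_le_card_mul_sum_sq
      _ ≤ (𝒯.neighbors T).card * ∑ T' ∈ 𝒯.neighbors T, Q T' := by
        refine mul_le_mul (by exact_mod_cast Finset.card_le_card hsub) ?_
          (Finset.sum_nonneg fun _ _ => sq_nonneg _) (by positivity)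
        exact (Finset.sum_le_sum fun T' hT' => hv T' (hmem T' hT').1 x (hmem T' hT').2).trans
          (Finset.sum_le_sum_of_subset_of_nonneg hsub fun T _ _ => hQ T)

/-- The cut is a segment with both endpoints in `T`; this length bound absorbs the weight `1 / h_T`
of the interface term. -/
lemma hausdorffMeasure_cut_le {T : Finset Plane} (hT : T ∈ 𝒯.cutElems) :
    μH[1] (hull T ∩ 𝒯.Γ) ≤ ENNReal.ofReal (size T) := by
  obtain ⟨hTe, hne⟩ := Finset.mem_filter.1 hT
  obtain ⟨a, b, hab⟩ := 𝒯.segment_cut T hTe hne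
  change hull T ∩ 𝒯.Γ = segment ℝ a b at hab
  have ha : a ∈ hull T ∩ 𝒯.Γ := by rw [hab]; exact left_mem_segment ℝ a b
  have hb : b ∈ hull T ∩ 𝒯.Γ := by rw [hab]; exact right_mem_segment ℝ a b
  rw [hab, hausdorffMeasure_segment, edist_dist]
  exact ENNReal.ofReal_le_ofReal (dist_le_size ha.1 hb.1)

lemma sum_interface_le (h : 𝒯.ShapeRegular σ) {k : Fin 2 → ℝ} (hk : ∀ i, 0 < k i) {v : Broken}
    {Q : Fin 2 → Finset Plane → ℝ} (hQ : ∀ i T, 0 ≤ Q i T)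
    (hv : ∀ i, ∀ T ∈ 𝒯.elems, ∀ x ∈ hull T, v i T x ^ 2 ≤ Q i T) :
    ∑ T ∈ 𝒯.cutElems, ∫ x in hull T ∩ 𝒯.Γ,
        kΓ k / size T * (𝒯.trace v 0 T x - 𝒯.trace v 1 T x) ^ 2 ∂μH[1]
      ≤ ∑ i, k i * (18 * (4 * σ ^ 2) ^ 2 * ∑ T ∈ 𝒯.elems, Q i T) := by
  set B := 3 * (4 * σ ^ 2) with hB
  have hB0 : 0 ≤ B := by positivity
  have h0 := hk 0
  have h1 := hk 1
  have hsub : 𝒯.cutElems ⊆ 𝒯.elems := Finset.filter_subset _ _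
  have hS : ∀ i T, 0 ≤ ∑ T' ∈ 𝒯.neighbors T, Q i T' := fun i T => Finset.sum_nonneg fun T _ => hQ i T
  have hstep : ∀ T ∈ 𝒯.cutElems, ∫ x in hull T ∩ 𝒯.Γ,
        kΓ k / size T * (𝒯.trace v 0 T x - 𝒯.trace v 1 T x) ^ 2 ∂μH[1]
      ≤ ∑ i, k i * (2 * B * ∑ T' ∈ 𝒯.neighbors T, Q i T') := by
    intro T hT
    have hTe := hsub hT
    have hsz := TriMesh.size_pos hTe
    have hS0 := hS 0 T
    have hS1 := hS 1 T
    have hk0 := kΓ_nonneg hk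
    set C := ∑ i, k i * (2 * B * ∑ T' ∈ 𝒯.neighbors T, Q i T') with hC
    have hC0 : 0 ≤ C := by rw [hC, Fin.sum_univ_two]; positivity
    have := setIntegral_le_mul (ν := μH[1]) (s := hull T ∩ 𝒯.Γ)
      (f := fun x => kΓ k / size T * (𝒯.trace v 0 T x - 𝒯.trace v 1 T x) ^ 2)
      (C := C / size T) (L := size T) (by positivity) hsz.le (hausdorffMeasure_cut_le hT) (by
        intro x hx
        rw [abs_of_nonneg (by positivity), div_mul_eq_mul_div]
        gcongr
        have e0 := trace_sq_le h (hQ 0) (hv 0) hTe hx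
        have e1 := trace_sq_le h (hQ 1) (hv 1) hTe hx
        have e2 : (𝒯.trace v 0 T x - 𝒯.trace v 1 T x) ^ 2
            ≤ 2 * 𝒯.trace v 0 T x ^ 2 + 2 * 𝒯.trace v 1 T x ^ 2 := by
          nlinarith [sq_nonneg (𝒯.trace v 0 T x + 𝒯.trace v 1 T x)]
        calc kΓ k * (𝒯.trace v 0 T x - 𝒯.trace v 1 T x) ^ 2
            ≤ kΓ k * (2 * 𝒯.trace v 0 T x ^ 2 + 2 * 𝒯.trace v 1 T x ^ 2) := by gcongr
          _ = kΓ k * (2 * 𝒯.trace v 0 T x ^ 2) + kΓ k * (2 * 𝒯.trace v 1 T x ^ 2) := by ring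
          _ ≤ k 0 * (2 * (B * ∑ T' ∈ 𝒯.neighbors T, Q 0 T')) +
              k 1 * (2 * (B * ∑ T' ∈ 𝒯.neighbors T, Q 1 T')) := by
            gcongr
            · exact kΓ_le hk 0
            · exact kΓ_le hk 1
          _ = C := by rw [hC, Fin.sum_univ_two]; ring)
    refine this.trans_eq ?_
    field_simp
  calc _ ≤ ∑ T ∈ 𝒯.cutElems, ∑ i, k i * (2 * B * ∑ T' ∈ 𝒯.neighbors T, Q i T') :=
        Finset.sum_le_sum hstep
    _ ≤ ∑ T ∈ 𝒯.elems, ∑ i, k i * (2 * B * ∑ T' ∈ 𝒯.neighbors T, Q i T') :=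
        Finset.sum_le_sum_of_subset_of_nonneg hsub fun T _ _ => Finset.sum_nonneg fun i _ =>
          mul_nonneg (hk i).le (mul_nonneg (by positivity) (hS i T))
    _ = ∑ i, k i * (2 * B * ∑ T ∈ 𝒯.elems, ∑ T' ∈ 𝒯.neighbors T, Q i T') := by
        rw [Finset.sum_comm]
        simp only [Finset.mul_sum]
    _ ≤ ∑ i, k i * (2 * B * (B * ∑ T ∈ 𝒯.elems, Q i T)) := by
        gcongr with i
        · exact (hk i).le
        · exact TriMesh.sum_neighbors_le h (hQ i)
    _ = _ := by
        refine Finset.sum_congr rfl fun i _ => ?_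
        rw [hB]; ring

/-- The norm of a piecewise affine function in terms of its values and its jumps. -/
lemma normHSq_le (h : 𝒯.ShapeRegular σ) {c : BoundaryEdges} {k : Fin 2 → ℝ} (hk : ∀ i, 0 < k i)
    {v : Broken} {Q : Fin 2 → Finset Plane → ℝ} (hQ : ∀ i T, 0 ≤ Q i T)
    (hv : ∀ i, ∀ T ∈ 𝒯.elems, ∀ x ∈ hull T, v i T x ^ 2 ≤ Q i T) :
    𝒯.normHSq c k v
      ≤ (4 * σ ^ 2 * Real.pi + 21 * (4 * σ ^ 2) ^ 2) * ∑ i, k i * ∑ T ∈ 𝒯.elems, Q i T := by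
  have h1 : ∀ i, k i * (∑ T ∈ 𝒯.subElems i, ∫ x in hull T ∩ 𝒯.sub i, ‖gradient (v i T) x‖ ^ 2)
      ≤ k i * (4 * σ ^ 2 * Real.pi * ∑ T ∈ 𝒯.elems, Q i T) := fun i =>
    mul_le_mul_of_nonneg_left (sum_gradient_le h (hQ i) (hv i)) (hk i).le
  have h2 : ∀ i, 𝒯.ghost c k v i ≤ k i * (3 * (4 * σ ^ 2) ^ 2 * ∑ T ∈ 𝒯.elems, Q i T) := fun i =>
    ghost_le h hk (hQ i) (hv i)
  have h3 := sum_interface_le h hk hQ hv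
  -- The constant `21` is `3` from the ghost penalty plus `18` from the interface.
  refine (add_le_add (Finset.sum_le_sum fun i _ => add_le_add (h1 i) (h2 i)) h3).trans_eq ?_
  rw [← Finset.sum_add_distrib, Finset.mul_sum]
  exact Finset.sum_congr rfl fun i _ => by ring

lemma normHSq_nonneg {c : BoundaryEdges} {k : Fin 2 → ℝ} (hk : ∀ i, 0 < k i) (v : Broken) :
    0 ≤ 𝒯.normHSq c k v := by
  refine add_nonneg (Finset.sum_nonneg fun i _ => add_nonneg (mul_nonneg (hk i).le ?_) ?_) ?_
  · exact Finset.sum_nonneg fun T _ => integral_nonneg fun x => by positivity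
  · exact Finset.sum_nonneg fun F _ => mul_nonneg (size_nonneg F) (integral_nonneg fun x =>
      mul_nonneg (hk i).le (sq_nonneg _))
  · exact Finset.sum_nonneg fun T _ => integral_nonneg fun x =>
      mul_nonneg (div_nonneg (kΓ_nonneg hk) (size_nonneg T)) (sq_nonneg _)

/-! ### The test function and the inf-sup inequality. -/

/-- A test function whose jumps are `h_F μ`, with bounded values. -/
lemma exists_jump_eq (σ : ℝ) : ∃ E : ℝ, 0 < E ∧ ∀ 𝒯 : CutMesh, 𝒯.ShapeRegular σ →
    ∀ c : BoundaryEdges, (c = .included → 𝒯.SimpleBoundary) → ∀ μ ∈ 𝒯.Mh c,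
    ∃ v ∈ 𝒯.Dh, (∀ i, ∀ F ∈ 𝒯.subEdges c i, ∀ x ∈ hull F, 𝒯.jumpVal v i F x = size F * μ i F x) ∧
    ∃ Q : Fin 2 → Finset Plane → ℝ, (∀ i T, 0 ≤ Q i T) ∧
      (∀ i, ∀ T ∈ 𝒯.elems, ∀ x ∈ hull T, v i T x ^ 2 ≤ Q i T) ∧
      ∀ i, ∑ T ∈ 𝒯.elems, Q i T ≤ E * ∑ F ∈ 𝒯.subEdges c i, ∑ N ∈ F, (size F * μ i F N) ^ 2 := by
  obtain ⟨C, hC0, hC⟩ := exists_nodal_values ⌈3 * (4 * σ ^ 2)⌉₊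
  -- The data at a node enter the bound once for each of the at most `4σ²` triangles there; the `1`
  -- only ensures positivity.
  refine ⟨C * (4 * σ ^ 2) + 1, by positivity, fun 𝒯 h c hc μ hμ => ?_⟩
  have hx : ∀ i N, ∃ x : Finset Plane → ℝ,
      (∀ F ∈ 𝒯.subEdges c i, N ∈ F → ∑ T ∈ 𝒯.subElems i, 𝒯.inc F T * x T = size F * μ i F N) ∧
      ∀ T, x T ^ 2 ≤ C * ∑ F ∈ (𝒯.subEdges c i).filter (fun F => N ∈ F),
        (size F * μ i F N) ^ 2 := by
    intro i N
    refine hC 𝒯 c hc i N ?_ ?_ (fun F => size F * μ i F N) ?_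
    · have h1 := TriMesh.card_elems_le h N
      have h2 : ((𝒯.elems.filter fun T => N ∈ T).card : ℝ) ≤ 3 * (4 * σ ^ 2) :=
        h1.trans (by nlinarith [sq_nonneg σ])
      exact_mod_cast h2.trans (Nat.le_ceil _)
    · exact_mod_cast (TriMesh.card_edges_le h N).trans (Nat.le_ceil _)
    · intro hN
      rw [← hμ.2 i N hN]
      exact Finset.sum_congr rfl fun F _ => by ring
  choose x hx1 hx2 using hx
  have hf : ∀ i T, ∃ f : Plane →ᵃ[ℝ] ℝ, (T ∈ 𝒯.elems → ∀ N ∈ T, f N = x i N T) := by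
    intro i T
    by_cases hT : T ∈ 𝒯.elems
    · obtain ⟨f, hf⟩ := TriMesh.exists_affine_interpolation hT (fun N => x i N T)
      exact ⟨f, fun _ => hf⟩
    · exact ⟨0, fun h => absurd h hT⟩
  choose f hf using hf
  set v : Broken := fun i T => if T ∈ 𝒯.subElems i then f i T else 0 with hv
  have hvN : ∀ i, ∀ T ∈ 𝒯.subElems i, ∀ N ∈ T, v i T N = x i N T := by
    intro i T hT N hN
    rw [hv]; dsimp only
    rw [if_pos hT]
    exact hf i T (Finset.mem_filter.1 hT).1 N hN
  have hv0 : ∀ i, ∀ T ∉ 𝒯.subElems i, v i T = 0 := fun i T hT => if_neg hT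
  set W : Fin 2 → Plane → ℝ := fun i N =>
    ∑ F ∈ (𝒯.subEdges c i).filter (fun F => N ∈ F), (size F * μ i F N) ^ 2 with hW
  have hW0 : ∀ i N, 0 ≤ W i N := fun i N => Finset.sum_nonneg fun _ _ => sq_nonneg _
  refine ⟨v, hv0, ?_, fun i T => ∑ N ∈ T, C * W i N,
    fun i T => Finset.sum_nonneg fun N _ => mul_nonneg hC0.le (hW0 i N), ?_, ?_⟩
  · intro i F hF y hy
    obtain ⟨g, hg⟩ := exists_affineMap_sum 𝒯.elems (fun T => 𝒯.inc F T) (fun T => v i T)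
    have hj : ∀ z, 𝒯.jumpVal v i F z = g z := by
      intro z; rw [hg, jumpVal, jump_eq_sum_inc]
    -- Jump and multiplier are both affine along the edge, so agreement at its endpoints suffices.
    have : g y = (size F • μ i F) y := by
      refine eq_of_mem_hull (fun N hN => ?_) hy
      rw [hg, AffineMap.coe_smul, Pi.smul_apply, smul_eq_mul, ← hx1 i N F hF hN]
      have hsub : 𝒯.subElems i ⊆ 𝒯.elems := Finset.filter_subset _ _
      rw [← Finset.sum_subset hsub]
      · refine Finset.sum_congr rfl fun T hT => ?_
        by_cases hFT : F ⊆ T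
        · rw [hvN i T hT N (hFT hN)]
        · rw [inc_eq_zero hFT, zero_mul, zero_mul]
      · intro T _ hT
        rw [hv0 i T hT]; simp
    rw [hj, this]; simp
  · intro i T hT y hy
    have hQ : 0 ≤ ∑ N ∈ T, C * W i N := Finset.sum_nonneg fun N _ => mul_nonneg hC0.le (hW0 i N)
    refine sq_le_of_mem_hull hQ (fun N hN => ?_) hy
    by_cases hTi : T ∈ 𝒯.subElems i
    · rw [hvN i T hTi N hN]
      exact (hx2 i N T).trans (Finset.single_le_sum (f := fun N => C * W i N)
        (fun N _ => mul_nonneg hC0.le (hW0 i N)) hN)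
    · rw [hv0 i T hTi]; simpa using hQ
  · intro i
    set G : Finset Plane → Plane → ℝ := fun F N => (size F * μ i F N) ^ 2 with hG
    have hG0 : ∀ F N, 0 ≤ G F N := fun F N => sq_nonneg _
    have e1 : ∀ T, ∑ N ∈ T, W i N
        = ∑ F ∈ 𝒯.subEdges c i, ∑ N ∈ F.filter (fun N => N ∈ T), G F N := by
      intro T
      refine Finset.sum_comm' fun N F => ?_
      simp only [Finset.mem_filter]
      tauto
    have e2 : ∑ T ∈ 𝒯.elems, ∑ N ∈ T, W i N
        = ∑ F ∈ 𝒯.subEdges c i, ∑ N ∈ F, ∑ T ∈ 𝒯.elems.filter (fun T => N ∈ T), G F N := by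
      simp only [e1]
      rw [Finset.sum_comm]
      refine Finset.sum_congr rfl fun F _ => Finset.sum_comm' fun T N => ?_
      simp only [Finset.mem_filter]
      tauto
    have e3 : ∑ T ∈ 𝒯.elems, ∑ N ∈ T, W i N
        ≤ 4 * σ ^ 2 * ∑ F ∈ 𝒯.subEdges c i, ∑ N ∈ F, G F N := by
      rw [e2]
      simp only [Finset.mul_sum]
      refine Finset.sum_le_sum fun F _ => Finset.sum_le_sum fun N _ => ?_
      rw [Finset.sum_const, nsmul_eq_mul]
      exact mul_le_mul_of_nonneg_right (TriMesh.card_elems_le h N) (hG0 F N)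
    have hS : 0 ≤ ∑ F ∈ 𝒯.subEdges c i, ∑ N ∈ F, G F N :=
      Finset.sum_nonneg fun F _ => Finset.sum_nonneg fun N _ => hG0 F N
    simp only [← Finset.mul_sum]
    calc C * ∑ T ∈ 𝒯.elems, ∑ N ∈ T, W i N
        ≤ C * (4 * σ ^ 2 * ∑ F ∈ 𝒯.subEdges c i, ∑ N ∈ F, G F N) := by gcongr
      _ ≤ _ := by nlinarith

/-- The inf-sup inequality for a given multiplier. -/
lemma exists_testFunction (σ : ℝ) : ∃ β : ℝ, 0 < β ∧ ∀ 𝒯 : CutMesh, 𝒯.ShapeRegular σ →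
    ∀ k : Fin 2 → ℝ, (∀ i, 0 < k i) →
    ∀ c : BoundaryEdges, (c = .included → 𝒯.SimpleBoundary) →
    ∀ μ ∈ 𝒯.Mh c, 𝒯.normM c k μ ≠ 0 → ∃ v ∈ 𝒯.Dh, 𝒯.normD c k v ≠ 0 ∧
      β ≤ 𝒯.b c k μ v / (𝒯.normM c k μ * 𝒯.normD c k v) := by
  obtain ⟨E, hE0, hE⟩ := exists_jump_eq σ
  set A := 4 * σ ^ 2 * Real.pi + 21 * (4 * σ ^ 2) ^ 2 with hA
  have hA0 : 0 ≤ A := by positivity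
  -- `b_h(μ, v) = S / 2`, whereas the norms are at most `√S` and `√((A E + 1) S)`.
  refine ⟨1 / (2 * √(A * E + 1)), by positivity, fun 𝒯 h k hk c hc μ hμ hM => ?_⟩
  obtain ⟨v, hv, hjump, Q, hQ0, hQ, hQE⟩ := hE 𝒯 h c hc μ hμ
  set S := ∑ i, k i * ∑ F ∈ 𝒯.subEdges c i, ∑ N ∈ F, (size F * μ i F N) ^ 2 with hS
  set m := ∑ i, ∑ F ∈ 𝒯.subEdges c i, ∫ x in hull F, k i * size F * (μ i F x) ^ 2 ∂μH[1] with hm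
  have hMm : 𝒯.normM c k μ = √m := rfl
  -- Since the jumps are `h_F μ`, the jump part of the norm of `v` is the squared norm of `μ`.
  have hjm : ∑ i, ∑ F ∈ 𝒯.subEdges c i,
      ∫ x in hull F, k i * (size F)⁻¹ * 𝒯.jumpVal v i F x ^ 2 ∂μH[1] = m := by
    refine Finset.sum_congr rfl fun i _ => Finset.sum_congr rfl fun F hF => ?_
    refine setIntegral_congr_fun (isCompact_hull F).isClosed.measurableSet fun x hx => ?_
    rw [hjump i F hF x hx]
    rcases eq_or_ne (size F) 0 with h0 | h0
    · rw [h0]; simp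
    · field_simp
  have hDm : 𝒯.normD c k v = √(𝒯.normHSq c k v + m) := by rw [normD, hjm]
  have hmS : m ≤ S := by
    rw [hm, hS]
    refine Finset.sum_le_sum fun i _ => ?_
    rw [Finset.mul_sum]
    refine Finset.sum_le_sum fun F hF => ?_
    have hFe := (Finset.mem_filter.1 hF).1
    have hki := (hk i).le
    have hsz := size_nonneg F
    have hP : 0 ≤ ∑ N ∈ F, μ i F N ^ 2 := Finset.sum_nonneg fun _ _ => sq_nonneg _
    have := setIntegral_le_mul (ν := μH[1]) (s := hull F)
      (f := fun x => k i * size F * (μ i F x) ^ 2)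
      (C := k i * size F * ∑ N ∈ F, μ i F N ^ 2) (L := size F)
      (mul_nonneg (mul_nonneg hki hsz) hP) hsz
      (hausdorffMeasure_hull_edge (TriMesh.card_edge hFe)) (by
        intro x hx
        rw [abs_of_nonneg (by positivity)]
        gcongr
        exact sq_le_of_mem_hull hP (fun N hN =>
          Finset.single_le_sum (f := fun N => μ i F N ^ 2) (fun _ _ => sq_nonneg _) hN) hx)
    refine this.trans_eq ?_
    simp only [mul_pow, ← Finset.mul_sum]
    ring
  have hm0 : 0 < m := by
    rw [hMm] at hM
    exact Real.sqrt_pos.1 (lt_of_le_of_ne (Real.sqrt_nonneg _) (Ne.symm hM))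
  have hS0 : 0 < S := hm0.trans_le hmS
  have hb : 𝒯.b c k μ v = S / 2 := by
    rw [b, hS, Finset.sum_div]
    refine Finset.sum_congr rfl fun i _ => ?_
    rw [Finset.mul_sum, Finset.sum_div]
    refine Finset.sum_congr rfl fun F hF => ?_
    rw [Finset.mul_sum, Finset.mul_sum, Finset.sum_div]
    refine Finset.sum_congr rfl fun N hN => ?_
    rw [hjump i F hF N (mem_hull_of_mem hN)]
    ring
  have hH0 := normHSq_nonneg (𝒯 := 𝒯) (c := c) hk v
  have hD : 𝒯.normHSq c k v + m ≤ (A * E + 1) * S := by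
    have h1 := normHSq_le (c := c) h hk hQ0 hQ
    have h2 : ∑ i, k i * ∑ T ∈ 𝒯.elems, Q i T ≤ E * S := by
      rw [hS, Finset.mul_sum]
      refine Finset.sum_le_sum fun i _ => ?_
      rw [mul_left_comm]
      exact mul_le_mul_of_nonneg_left (hQE i) (hk i).le
    have h3 := mul_le_mul_of_nonneg_left h2 hA0
    linarith
  have hD0 : 0 < 𝒯.normD c k v := by
    rw [hDm]; exact Real.sqrt_pos.2 (by linarith)
  refine ⟨v, hv, hD0.ne', ?_⟩
  have hM0 : 0 < 𝒯.normM c k μ := by rw [hMm]; exact Real.sqrt_pos.2 hm0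
  have hprod : 𝒯.normM c k μ * 𝒯.normD c k v ≤ √(A * E + 1) * S := by
    calc 𝒯.normM c k μ * 𝒯.normD c k v ≤ √S * √((A * E + 1) * S) := by
          rw [hMm, hDm]
          exact mul_le_mul (Real.sqrt_le_sqrt hmS) (Real.sqrt_le_sqrt hD) (Real.sqrt_nonneg _)
            (Real.sqrt_nonneg _)
      _ = √(A * E + 1) * (√S * √S) := by rw [Real.sqrt_mul (by positivity)]; ring
      _ = _ := by rw [Real.mul_self_sqrt hS0.le]
  have hr : 0 < √(A * E + 1) := by positivity
  rw [hb, div_le_div_iff₀ (by positivity) (by positivity)]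
  linarith

end CutMesh
end CutFEM
end
open CutFEM in
theorem theorem1 (σ : ℝ) :
    ∃ β : ℝ, 0 < β ∧
      ∀ 𝒯 : CutMesh, 𝒯.ShapeRegular σ →
      ∀ k : Fin 2 → ℝ, (∀ i, 0 < k i) →
      ∀ c : BoundaryEdges, (c = .included → 𝒯.SimpleBoundary) →
        (β : EReal) ≤
          ⨅ μ ∈ {μ : Broken | μ ∈ 𝒯.Mh c ∧ 𝒯.normM c k μ ≠ 0},
            ⨆ v ∈ {v : Broken | v ∈ 𝒯.Dh ∧ 𝒯.normD c k v ≠ 0},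
              ((𝒯.b c k μ v / (𝒯.normM c k μ * 𝒯.normD c k v) : ℝ) : EReal) := by
  obtain ⟨β, hβ, h⟩ := CutMesh.exists_testFunction σ
  refine ⟨β, hβ, fun 𝒯 hσ k hk c hc => le_iInf₂ fun μ hμ => ?_⟩
  obtain ⟨v, hv, hvD, hle⟩ := h 𝒯 hσ k hk c hc μ hμ.1 hμ.2
  exact le_iSup₂_of_le v ⟨hv, hvD⟩ (EReal.coe_le_coe_iff.2 hle)
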